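/- For a set $S\subset\mathbb{R}^d$ let $\mathrm{dm}(S)$ be the largest $k\ge -1$ such that $S$ includes a $k$-simplex (the convex hull of $k+1$ affinely independent points), and for $p\in S$ let $\mathrm{dm}(S,p)=\min_{\epsilon>0}\mathrm{dm}(S\cap B(p,\epsilon))$. A $k$-flat is a $k$-dimensional affine subspace. A strong cover of $S$ is a finite collection $\mathcal{C}$ of flats such that every $p\in S$ belongs to some flat of $\mathcal{C}$ of dimension $\mathrm{dm}(S,p)$, and such that no proper subcollection of $\mathcal{C}$ has this property. A $k$-flat $H$ is a $k$-ordinary flat of $S$ if there are a point $p\in S$ with $\mathrm{dm}(S,p)=k$ and an open neighbourhood $U$ of $p$ with $S\cap U=H\cap U$. For $d,n,k$ consider all sets $S=\mathbb{R}^d\setminus(K_1\cup\dots\cup K_n)$ with $K_1,\dots,K_n\subset\mathbb{R}^d$ convex. Let $\nu_k(d,n)$ be the maximum, over all such $S$, of the number of $k$-flats in a strong cover of $S$, and let $o_k(d,n)$ be the maximum, over all such $S$, of the number of $k$-ordinary flats of $S$. Then for every $n$: (a) in the plane, $\nu_1(2,n)=o_1(2,n)=t(n,4)$, where $t(n,4)$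 is the Turán number, i.e. the number of edges of the complete $4$-partite graph on $n$ vertices with parts as equal as possible; and $t(n,4)=\left(\tfrac34+o(1)\right)\binom n2$ as $n\to\infty$; (b) for every $d\ge 3$, $\nu_{d-1}(d,n)=o_{d-1}(d,n)=\binom n2$. In particular all these maxima exist, i.e. the bounds hold for all such $S$ and are attained. -/

import Mathlib

open Set Filter Topology

section FlatCovers

variable {E : Type*} [NormedAddCommGroup E] [NormedSpace ℝ E]

/-- `S` includes a `k`-simplex: the convex hull of `k + 1` affinely independent points.
For `k = -1` the simplex is empty. -/
def IncludesSimplex (S : Set E) (k : ℤ) : Prop :=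
  ∃ (m : ℕ) (v : Fin m → E),
    (m : ℤ) = k + 1 ∧ AffineIndependent ℝ v ∧ convexHull ℝ (range v) ⊆ S

/-- The flat-dimension `dm(S)`: the largest `k ≥ -1` such that `S` includes a `k`-simplex.
In a space of finite dimension `d` the set on the right contains `-1` and is bounded above by `d`,
so that the supremum is a maximum. -/
noncomputable def flatDim (S : Set E) : ℤ :=
  sSup {k : ℤ | IncludesSimplex S k}

/-- The local dimension `dm(S, p)`: the minimum over `ε > 0` of `dm(S ∩ B(p, ε))`. -/
noncomputable def localDim (S : Set E) (p : E) : ℤ :=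
  sInf {k : ℤ | ∃ ε : ℝ, 0 < ε ∧ k = flatDim (S ∩ Metric.ball p ε)}

/-- A `k`-flat: a (nonempty) affine subspace of dimension `k`. -/
def IsFlat (k : ℕ) (H : AffineSubspace ℝ E) : Prop :=
  (H : Set E).Nonempty ∧ Module.finrank ℝ H.direction = k

/-- Every point `p` of `S` lies on a member of `C` of dimension `dm(S, p)`. -/
def CoversByLocalDim (S : Set E) (C : Set (AffineSubspace ℝ E)) : Prop :=
  ∀ p ∈ S, ∃ H ∈ C, p ∈ H ∧ ∃ k : ℕ, IsFlat k H ∧ (k : ℤ) = localDim S p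

/-- A strong cover of `S`: a finite collection of flats such that every `p ∈ S` lies on one of them
of dimension `dm(S, p)`, and that is minimal with this property. -/
structure IsStrongCover (S : Set E) (C : Set (AffineSubspace ℝ E)) : Prop where
  finite : C.Finite
  flats : ∀ H ∈ C, (H : Set E).Nonempty
  covers : CoversByLocalDim S C
  minimal : ∀ C' : Set (AffineSubspace ℝ E), C' ⊂ C → ¬ CoversByLocalDim S C'

/-- `H` is a `k`-ordinary flat of `S`: it is a `k`-flat and there is a point `p ∈ S` with
`dm(S, p) = k` near which `S` coincides with `H`. -/
def IsOrdinaryFlat (k : ℕ) (S : Set E) (H : AffineSubspace ℝ E) : Prop :=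
  IsFlat k H ∧ ∃ p ∈ S, localDim S p = k ∧
    ∃ U : Set E, IsOpen U ∧ p ∈ U ∧ S ∩ U = (H : Set E) ∩ U

end FlatCovers

/-- The numbers of `k`-flats in the strong cover of `S`, where `S` runs over the complements in
`ℝ^d` of unions of `n` convex sets. The maximum of this set is `ν_k(d, n)`. -/
def strongCoverCounts (k d n : ℕ) : Set ℕ∞ :=
  {m | ∃ K : Fin n → Set (EuclideanSpace ℝ (Fin d)), (∀ i, Convex ℝ (K i)) ∧
    ∃ C, IsStrongCover (⋃ i, K i)ᶜ C ∧ m = {H | H ∈ C ∧ IsFlat k H}.encard}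

/-- The numbers of `k`-ordinary flats of `S`, where `S` runs over the complements in `ℝ^d` of
unions of `n` convex sets. -/
def ordinaryFlatCounts (k d n : ℕ) : Set ℕ∞ :=
  {m | ∃ K : Fin n → Set (EuclideanSpace ℝ (Fin d)), (∀ i, Convex ℝ (K i)) ∧
    m = {H | IsOrdinaryFlat k (⋃ i, K i)ᶜ H}.encard}

/-- The Turán number `t(n, r)`: the number of edges of the Turán graph, the complete `r`-partite
graph on `n` vertices with parts as equal as possible. -/
def turanNumber (n r : ℕ) : ℕ :=
  (SimpleGraph.turanGraph n r).edgeFinset.card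

/-! The `k`-flats of a strong cover are exactly the `k`-ordinary flats
(`IsStrongCover.setOf_isFlat_eq`), so only ordinary hyperplanes have to be counted. This rests on
one fact: a convex set covered by finitely many flats lies in one of them.

Upper bounds. Near an ordinary hyperplane `H` the convex sets fill both sides and avoid `H`. As they
are finitely many, one of them contains a half-ball on each side, so two of them touch along a piece
of `H` and are separated by it. A pair touches along at most one hyperplane, so there are at most as
many ordinary hyperplanes as edges of `touchGraph K`. For `d ≥ 3` the trivial bound `n.choose 2`
suffices. In the plane, five pairwise touching sets would give a drawing of the complete graph on
five vertices in which disjoint edges do not meet, each edge going from an interior point to a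
contact point to an interior point. A parity count excludes this (`touchGraph_cliqueFree_five`), and
Turán's theorem bounds the edges.

Lower bounds. An `IsWallSystem` on a complete multipartite graph has one open polyhedral cell per
vertex, and each edge gives its own ordinary hyperplane. For `d ≥ 3` the cells come from tangency to
quartics, as for cyclic polytopes. In the plane, four regions with pairwise common sides are each
replaced by the cells of one part; along each side the single wall is perturbed into a family of
lines, one for each pair of cells, so that every cell of one region touches every cell of the other.
-/

section Dimension

/-! ### Flat-dimension and local dimension. -/

variable {E : Type*} [NormedAddCommGroup E] [NormedSpace ℝ E]

/-- A line that meets an affine subspace in two points is contained in it. -/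
theorem AffineSubspace.lineMap_mem_of_two_mem {H : AffineSubspace ℝ E} {a b : E} {s t : ℝ}
    (hst : s ≠ t) (hs : AffineMap.lineMap a b s ∈ H) (ht : AffineMap.lineMap a b t ∈ H) (r : ℝ) :
    AffineMap.lineMap a b r ∈ H := by
  have h := AffineMap.lineMap_mem ((r - s) / (t - s)) hs ht
  convert h using 1
  have : t - s ≠ 0 := sub_ne_zero.2 hst.symm
  simp only [AffineMap.lineMap_apply_module]
  match_scalars <;> field_simp <;> ring

/-- A nonempty convex set covered by finitely many affine subspaces is contained in one of them. -/
theorem Convex.exists_subset_of_subset_biUnion {A : Set E} (hA : Convex ℝ A) (hne : A.Nonempty)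
    {C : Set (AffineSubspace ℝ E)} (hC : C.Finite) (h : A ⊆ ⋃ H ∈ C, (H : Set E)) :
    ∃ H ∈ C, A ⊆ (H : Set E) := by
  induction C, hC using Set.Finite.induction_on with
  | empty => obtain ⟨x, hx⟩ := hne; simpa using h hx
  | @insert H₀ C _ hC ih =>
    by_cases hH₀ : A ⊆ (H₀ : Set E)
    · exact ⟨H₀, mem_insert _ _, hH₀⟩
    obtain ⟨a, haA, haH⟩ := not_subset.1 hH₀
    suffices hs : A ⊆ ⋃ H ∈ C, (H : Set E) by
      obtain ⟨H, hH, hAH⟩ := ih hs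
      exact ⟨H, mem_insert_of_mem _ hH, hAH⟩
    intro b hb
    by_cases hbH : b ∈ H₀
    swap
    · have := h hb
      simp only [biUnion_insert, mem_union, SetLike.mem_coe, hbH, false_or] at this
      exact this
    -- The half-open segment from `a` towards `b` misses `H₀`, since a line with two points in `H₀`
    -- would put `a` there. By pigeonhole two of its points share a flat of `C`, which then contains
    -- `b`.
    have key : ∀ t ∈ Ico (0 : ℝ) 1, ∃ H ∈ C, AffineMap.lineMap a b t ∈ H := by
      intro t ht
      have hmem : AffineMap.lineMap a b t ∈ A := hA.lineMap_mem haA hb ⟨ht.1, ht.2.le⟩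
      have := h hmem
      simp only [biUnion_insert, mem_union, SetLike.mem_coe, mem_iUnion, exists_prop] at this
      rcases this with h1 | h1
      · exfalso
        apply haH
        have h2 : AffineMap.lineMap a b (1 : ℝ) ∈ H₀ := by simpa using hbH
        simpa using AffineSubspace.lineMap_mem_of_two_mem ht.2.ne h1 h2 0
      · exact h1
    choose! F hFC hF using key
    obtain ⟨s, hs, t, ht, hst, hFst⟩ :=
      (Ico_infinite (zero_lt_one (α := ℝ))).exists_ne_map_eq_of_mapsTo (f := F)
        (fun t ht => hFC t ht) hC
    have h1 := hF s hs
    have h2 := hF t ht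
    rw [← hFst] at h2
    have := AffineSubspace.lineMap_mem_of_two_mem hst h1 h2 1
    rw [AffineMap.lineMap_apply_one] at this
    exact mem_biUnion (hFC s hs) this

theorem IncludesSimplex.mono {S T : Set E} {k : ℤ} (h : IncludesSimplex S k) (hST : S ⊆ T) :
    IncludesSimplex T k := by
  obtain ⟨m, v, hm, hv, hs⟩ := h
  exact ⟨m, v, hm, hv, hs.trans hST⟩

theorem includesSimplex_neg_one (S : Set E) : IncludesSimplex S (-1) := by
  refine ⟨0, Fin.elim0, by simp, affineIndependent_of_subsingleton ℝ _, ?_⟩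
  simp [range_eq_empty]

/-- A ball around a point of an affine subspace spans that subspace. -/
theorem AffineSubspace.le_of_inter_ball_subset {H H' : AffineSubspace ℝ E} {p : E} (hp : p ∈ H)
    {ε : ℝ} (hε : 0 < ε) (h : (H : Set E) ∩ Metric.ball p ε ⊆ (H' : Set E)) : H ≤ H' := by
  intro x hx
  have hpH' : p ∈ H' := h ⟨hp, Metric.mem_ball_self hε⟩
  obtain ⟨c, hc0, hc⟩ : ∃ c : ℝ, 0 < c ∧ c * dist p x < ε := by
    refine ⟨ε / (dist p x + 1), by positivity, ?_⟩
    rw [div_mul_eq_mul_div, div_lt_iff₀ (by positivity)]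
    nlinarith
  have h1 : AffineMap.lineMap p x c ∈ H' := by
    apply h
    refine ⟨AffineMap.lineMap_mem c hp hx, ?_⟩
    rwa [Metric.mem_ball, dist_lineMap_left, Real.norm_of_nonneg hc0.le]
  have h0 : AffineMap.lineMap p x (0 : ℝ) ∈ H' := by simpa using hpH'
  simpa using lineMap_mem_of_two_mem hc0.ne h0 h1 1

section FiniteDimensional

variable [FiniteDimensional ℝ E]

theorem AffineIndependent.natCast_le_of_range_subset {m : ℕ} {v : Fin m → E}
    (hv : AffineIndependent ℝ v) {H : AffineSubspace ℝ E} (h : range v ⊆ (H : Set E)) :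
    (m : ℤ) ≤ Module.finrank ℝ H.direction + 1 := by
  have h1 := hv.card_le_finrank_succ
  have h2 : vectorSpan ℝ (range v) ≤ H.direction := by
    rw [← direction_affineSpan]
    exact AffineSubspace.direction_le (affineSpan_le.2 h)
  have h3 := Submodule.finrank_mono h2
  simp only [Fintype.card_fin] at h1
  omega

/-- A simplex is convex, so it fits into a single one of the flats. The bound `-1 ≤ n` takes care of
the empty simplex. -/
theorem IncludesSimplex.le_of_subset_biUnion {S : Set E} {k : ℤ} (h : IncludesSimplex S k)
    {C : Set (AffineSubspace ℝ E)} (hC : C.Finite) (hS : S ⊆ ⋃ H ∈ C, (H : Set E)) {n : ℤ}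
    (hn : -1 ≤ n) (hCn : ∀ H ∈ C, (Module.finrank ℝ H.direction : ℤ) ≤ n) : k ≤ n := by
  obtain ⟨m, v, hm, hv, hs⟩ := h
  rcases Nat.eq_zero_or_pos m with rfl | hpos
  · simp at hm; omega
  have : Nonempty (Fin m) := ⟨⟨0, hpos⟩⟩
  obtain ⟨H, hH, hsub⟩ := (convex_convexHull ℝ (range v)).exists_subset_of_subset_biUnion
    (range_nonempty v).convexHull hC (hs.trans hS)
  have := hv.natCast_le_of_range_subset ((subset_convexHull ℝ _).trans hsub)
  have := hCn H hH
  omega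

theorem bddAbove_includesSimplex (S : Set E) : BddAbove {k : ℤ | IncludesSimplex S k} := by
  refine ⟨Module.finrank ℝ E, fun k hk => ?_⟩
  refine hk.le_of_subset_biUnion (C := {⊤}) (finite_singleton _) (by simp) (by omega) ?_
  rintro H -
  exact_mod_cast Submodule.finrank_le _

theorem IncludesSimplex.le_flatDim {S : Set E} {k : ℤ} (h : IncludesSimplex S k) :
    k ≤ flatDim S :=
  le_csSup (bddAbove_includesSimplex S) h

theorem includesSimplex_flatDim (S : Set E) : IncludesSimplex S (flatDim S) :=
  Int.csSup_mem ⟨-1, includesSimplex_neg_one S⟩ (bddAbove_includesSimplex S)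

theorem flatDim_mono {S T : Set E} (h : S ⊆ T) : flatDim S ≤ flatDim T :=
  ((includesSimplex_flatDim S).mono h).le_flatDim

theorem bddBelow_flatDim_ball (S : Set E) (p : E) :
    BddBelow {k : ℤ | ∃ ε : ℝ, 0 < ε ∧ k = flatDim (S ∩ Metric.ball p ε)} := by
  refine ⟨-1, ?_⟩
  rintro k ⟨ε, -, rfl⟩
  exact (includesSimplex_neg_one _).le_flatDim

theorem localDim_le_flatDim (S : Set E) (p : E) {ε : ℝ} (hε : 0 < ε) :
    localDim S p ≤ flatDim (S ∩ Metric.ball p ε) :=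
  csInf_le (bddBelow_flatDim_ball S p) ⟨ε, hε, rfl⟩

theorem exists_localDim_eq (S : Set E) (p : E) :
    ∃ ε > 0, localDim S p = flatDim (S ∩ Metric.ball p ε) :=
  Int.csInf_mem (s := {k : ℤ | ∃ ε : ℝ, 0 < ε ∧ k = flatDim (S ∩ Metric.ball p ε)})
    ⟨_, 1, one_pos, rfl⟩ (bddBelow_flatDim_ball S p)

/-- The local dimension is attained on all sufficiently small balls. -/
theorem exists_forall_flatDim_eq (S : Set E) (p : E) :
    ∃ ε > 0, ∀ δ, 0 < δ → δ ≤ ε → flatDim (S ∩ Metric.ball p δ) = localDim S p := by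
  obtain ⟨ε, hε, h⟩ := exists_localDim_eq S p
  refine ⟨ε, hε, fun δ hδ hδε => le_antisymm ?_ (localDim_le_flatDim S p hδ)⟩
  rw [h]
  exact flatDim_mono (inter_subset_inter_right _ (Metric.ball_subset_ball hδε))

/-- Upper semicontinuity of the local dimension. -/
theorem localDim_le_of_mem_ball {S : Set E} {p q : E} {ε : ℝ} (hq : q ∈ Metric.ball p ε) :
    localDim S q ≤ flatDim (S ∩ Metric.ball p ε) := by
  obtain ⟨δ, hδ, h⟩ := Metric.isOpen_iff.1 Metric.isOpen_ball q hq
  exact (localDim_le_flatDim S q hδ).trans (flatDim_mono (inter_subset_inter_right _ h))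

/-- A homothety centred at `p` shrinks a maximal affinely independent subset of `A` into the ball,
and convexity keeps it inside `A`. -/
theorem Convex.includesSimplex_inter_ball {A : Set E} (hA : Convex ℝ A) {p : E} (hp : p ∈ A)
    {ε : ℝ} (hε : 0 < ε) :
    IncludesSimplex (A ∩ Metric.ball p ε) (Module.finrank ℝ (affineSpan ℝ A).direction) := by
  obtain ⟨t, htA, hspan, hind⟩ := exists_affineIndependent ℝ E A
  have htfin : t.Finite := finite_set_of_fin_dim_affineIndependent ℝ hind
  have := htfin.fintype
  have htne : t.Nonempty := by
    rw [← affineSpan_nonempty ℝ, hspan]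
    exact ⟨p, subset_affineSpan ℝ _ hp⟩
  have : Nonempty t := htne.to_subtype
  have hcard := hind.finrank_vectorSpan_add_one
  rw [Subtype.range_coe, ← direction_affineSpan, hspan] at hcard
  obtain ⟨R, hR, htR⟩ : ∃ R > 0, t ⊆ Metric.ball p R := by
    obtain ⟨R, hR⟩ := htfin.isBounded.subset_ball p
    exact ⟨max R 1, by positivity, hR.trans (Metric.ball_subset_ball (le_max_left _ _))⟩
  obtain ⟨c, hc0, hc1, hcR⟩ : ∃ c : ℝ, 0 < c ∧ c ≤ 1 ∧ c * R ≤ ε := by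
    refine ⟨min 1 (ε / R), by positivity, min_le_left _ _, ?_⟩
    calc min 1 (ε / R) * R ≤ ε / R * R := by gcongr; exact min_le_right _ _
      _ = ε := by field_simp
  let f : E →ᵃ[ℝ] E := AffineMap.homothety p c
  have hf : Function.Injective f := by
    intro x y hxy
    simp only [f, AffineMap.homothety_apply, vsub_eq_sub, vadd_eq_add, add_left_inj] at hxy
    simpa [hc0.ne'] using smul_right_injective E hc0.ne' hxy
  have hind' := hind.map' f hf
  let e := Fintype.equivFin t
  refine ⟨Fintype.card t, (f ∘ (↑) : t → E) ∘ e.symm, by rw [← hcard]; push_cast; ring,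
    hind'.comp_embedding e.symm.toEmbedding, ?_⟩
  refine convexHull_min ?_ (hA.inter (convex_ball p ε))
  rintro _ ⟨i, rfl⟩
  set x := e.symm i
  have hfx : f x = AffineMap.lineMap p (x : E) c := rfl
  refine ⟨?_, ?_⟩
  · simp only [Function.comp_apply]
    rw [hfx]
    exact hA.lineMap_mem hp (htA x.2) ⟨hc0.le, hc1⟩
  · simp only [Function.comp_apply]
    rw [hfx, Metric.mem_ball, dist_lineMap_left, Real.norm_of_nonneg hc0.le]
    have : dist p (x : E) < R := by rw [dist_comm]; exact htR x.2
    calc c * dist p x < c * R := by gcongr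
      _ ≤ ε := hcR

theorem AffineSubspace.eq_of_le_of_finrank_le {H H' : AffineSubspace ℝ E}
    (hH : (H : Set E).Nonempty) (hle : H ≤ H')
    (hd : Module.finrank ℝ H'.direction ≤ Module.finrank ℝ H.direction) : H = H' :=
  eq_of_direction_eq_of_nonempty_of_le
    (Submodule.eq_of_le_of_finrank_le (direction_le hle) hd) hH hle

/-- Used at points other than the one that witnesses ordinariness: the local dimension is `k` all
over the flat piece. -/
theorem IsFlat.localDim_eq {k : ℕ} {H : AffineSubspace ℝ E} (hH : IsFlat k H) {S U : Set E}
    (hU : IsOpen U) (hSU : S ∩ U = (H : Set E) ∩ U) {q : E} (hqH : q ∈ H) (hqU : q ∈ U) :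
    localDim S q = k := by
  obtain ⟨r, hr, hrU⟩ := Metric.isOpen_iff.1 hU q hqU
  have hball : ∀ δ, δ ≤ r → S ∩ Metric.ball q δ = (H : Set E) ∩ Metric.ball q δ := by
    intro δ hδ
    have hsub : Metric.ball q δ ⊆ U := (Metric.ball_subset_ball hδ).trans hrU
    rw [← inter_eq_self_of_subset_right hsub, ← inter_assoc, ← inter_assoc, hSU]
  obtain ⟨ε, hε, h⟩ := exists_forall_flatDim_eq S q
  rw [← h (min ε r) (by positivity) (min_le_left _ _), hball _ (min_le_right _ _)]
  apply le_antisymm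
  · refine (includesSimplex_flatDim _).le_of_subset_biUnion (C := {H}) (finite_singleton _)
      (by simp) (by omega) ?_
    simp [hH.2]
  · have := Convex.includesSimplex_inter_ball H.convex hqH (ε := min ε r) (by positivity)
    rw [AffineSubspace.affineSpan_coe, hH.2] at this
    exact this.le_flatDim

end FiniteDimensional

end Dimension

/-! ### Strong covers and ordinary flats. -/

section StrongCovers

/-- A point has a ball around it that misses those of finitely many closed sets that do not
contain it. -/
theorem exists_ball_forall_mem_of_mem {E ι : Type*} [PseudoMetricSpace E] {I : Set ι}
    (hI : I.Finite) {F : ι → Set E}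
    (hF : ∀ i ∈ I, IsClosed (F i)) (p : E) :
    ∃ ε > 0, ∀ x ∈ Metric.ball p ε, ∀ i ∈ I, x ∈ F i → p ∈ F i := by
  have h : ∀ᶠ x in 𝓝 p, ∀ i ∈ I, x ∈ F i → p ∈ F i := by
    rw [eventually_all_finite hI]
    intro i hi
    by_cases hp : p ∈ F i
    · exact Eventually.of_forall fun _ _ => hp
    · filter_upwards [(hF i hi).isOpen_compl.mem_nhds hp] with x hx hx'
      exact absurd hx' hx
  obtain ⟨ε, hε, hball⟩ := Metric.mem_nhds_iff.1 h
  exact ⟨ε, hε, fun x hx => hball hx⟩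

variable {E : Type*} [NormedAddCommGroup E] [NormedSpace ℝ E]

/-- A finite covering collection contains a minimal one. -/
theorem CoversByLocalDim.exists_isStrongCover {S : Set E} {C : Set (AffineSubspace ℝ E)}
    (h : CoversByLocalDim S C) (hC : C.Finite) (hne : ∀ H ∈ C, (H : Set E).Nonempty) :
    ∃ C' ⊆ C, IsStrongCover S C' := by
  have hfin : {D | D ⊆ C ∧ CoversByLocalDim S D}.Finite :=
    hC.finite_subsets.subset fun D hD => hD.1
  have hmem : C ∈ {D | D ⊆ C ∧ CoversByLocalDim S D} := ⟨Subset.rfl, h⟩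
  obtain ⟨C', hC'C, hmin⟩ := hfin.exists_le_minimal hmem
  refine ⟨C', hC'C, hC.subset hC'C, fun H hH => hne H (hC'C hH), hmin.prop.2, ?_⟩
  intro D hD hcov
  exact hD.2 (hmin.2 ⟨hD.1.trans hC'C, hcov⟩ hD.1)

theorem IsFlat.eq_of_le {k : ℕ} [FiniteDimensional ℝ E] {H H' : AffineSubspace ℝ E}
    (hH : IsFlat k H) (hle : H ≤ H')
    (hd : Module.finrank ℝ H'.direction ≤ k) : H = H' :=
  AffineSubspace.eq_of_le_of_finrank_le hH.1 hle (by rw [hH.2]; exact hd)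

variable [FiniteDimensional ℝ E]

theorem Convex.exists_affineSpan_inter_ball_subset {A : Set E} (hA : Convex ℝ A)
    (hne : A.Nonempty) :
    ∃ q ∈ A, ∃ r > 0, (affineSpan ℝ A : Set E) ∩ Metric.ball q r ⊆ A := by
  obtain ⟨q, hq⟩ := hne.intrinsicInterior hA
  obtain ⟨y, hy, rfl⟩ := mem_intrinsicInterior.1 hq
  obtain ⟨r, hr, h⟩ := Metric.mem_nhds_iff.1 (mem_interior_iff_mem_nhds.1 hy)
  exact ⟨y, intrinsicInterior_subset hq, r, hr, fun x hx => h (a := ⟨x, hx.1⟩) hx.2⟩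

/-- Every `k`-flat of a strong cover is a `k`-ordinary flat. -/
theorem IsStrongCover.isOrdinaryFlat {S : Set E} {C : Set (AffineSubspace ℝ E)}
    (hC : IsStrongCover S C) {k : ℕ} {H : AffineSubspace ℝ E} (hHC : H ∈ C) (hH : IsFlat k H) :
    IsOrdinaryFlat k S H := by
  -- Minimality gives a point `p` that only `H` covers in the right dimension.
  have hnot := hC.minimal (C \ {H}) ⟨sdiff_subset, fun h => (h hHC).2 rfl⟩
  simp only [CoversByLocalDim, not_forall] at hnot
  obtain ⟨p, hpS, hp⟩ := hnot
  have hother : ∀ H' ∈ C, p ∈ H' → ∀ k' : ℕ, IsFlat k' H' → (k' : ℤ) = localDim S p → H' = H := by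
    intro H' hH' hpH' k' hk' hk'p
    by_contra hne
    exact hp ⟨H', ⟨hH', hne⟩, hpH', k', hk', hk'p⟩
  obtain ⟨hpH, hpk⟩ : p ∈ H ∧ (k : ℤ) = localDim S p := by
    obtain ⟨H', hH', hpH', k', hk', hk'p⟩ := hC.covers p hpS
    obtain rfl := hother H' hH' hpH' k' hk' hk'p
    obtain rfl : k = k' := hH.2.symm.trans hk'.2
    exact ⟨hpH', hk'p⟩
  have hclosed : ∀ H ∈ C, IsClosed ((H : Set E)) := fun H _ => H.closed_of_finiteDimensional
  obtain ⟨ε₁, hε₁, hfar⟩ := exists_ball_forall_mem_of_mem hC.finite hclosed p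
  obtain ⟨ε₂, hε₂, hflat⟩ := exists_forall_flatDim_eq S p
  set ε := min ε₁ ε₂ with hε
  have hε0 : 0 < ε := by positivity
  have hdim : flatDim (S ∩ Metric.ball p ε) = k := by
    rw [hflat ε hε0 (min_le_right _ _), hpk]
  -- the flats of dimension at most `k` cover `S` near `p`
  set D := {H' | H' ∈ C ∧ Module.finrank ℝ H'.direction ≤ k} with hD
  have hDfin : D.Finite := hC.finite.subset fun _ h => h.1
  have hcov : ∀ x ∈ S ∩ Metric.ball p ε, ∃ H' ∈ D, x ∈ H' := by
    rintro x ⟨hxS, hxp⟩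
    obtain ⟨H', hH', hxH', k', hk', hk'x⟩ := hC.covers x hxS
    refine ⟨H', ⟨hH', ?_⟩, hxH'⟩
    have := localDim_le_of_mem_ball (S := S) hxp
    rw [hdim, ← hk'x] at this
    rw [hk'.2]
    exact_mod_cast this
  -- A `k`-simplex of `S` close to `p` lies in one flat of `D`, which must have dimension `k` and,
  -- by the choice of `ε`, contain `p`; so it is `H`.
  obtain ⟨m, v, hm, hv, hσ⟩ : IncludesSimplex (S ∩ Metric.ball p ε) k := by
    rw [← hdim]; exact includesSimplex_flatDim _
  set σ := convexHull ℝ (range v) with hσdef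
  have hmpos : 0 < m := by omega
  have : Nonempty (Fin m) := ⟨⟨0, hmpos⟩⟩
  have hσne : σ.Nonempty := (range_nonempty v).convexHull
  have hσconv : Convex ℝ σ := convex_convexHull ℝ _
  obtain ⟨H', hH'D, hσH'⟩ := hσconv.exists_subset_of_subset_biUnion hσne hDfin (fun x hx => by
    obtain ⟨H', h1, h2⟩ := hcov x (hσ hx)
    exact mem_biUnion h1 h2)
  have hH'k : IsFlat k H' := by
    refine ⟨hσne.mono hσH', le_antisymm hH'D.2 ?_⟩
    have := hv.natCast_le_of_range_subset ((subset_convexHull ℝ _).trans hσH')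
    omega
  obtain rfl : H' = H := by
    obtain ⟨x, hx⟩ := hσne
    refine hother H' hH'D.1 ?_ k hH'k hpk
    exact hfar x (Metric.ball_subset_ball (min_le_left _ _) (hσ hx).2) H' hH'D.1 (hσH' hx)
  have hspan : affineSpan ℝ σ = H' := by
    refine AffineSubspace.eq_of_le_of_finrank_le ((affineSpan_nonempty ℝ).2 hσne)
      (affineSpan_le.2 hσH') ?_
    have := hv.natCast_le_of_range_subset (H := affineSpan ℝ σ)
      ((subset_convexHull ℝ _).trans (subset_affineSpan ℝ _))
    rw [hH'k.2]; omega
  obtain ⟨q₀, hq₀, r, hr, hq₀r⟩ := hσconv.exists_affineSpan_inter_ball_subset hσne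
  rw [hspan] at hq₀r
  -- a point of the simplex that lies on no other flat of dimension at most `k`
  obtain ⟨q, hqV, hq⟩ : ∃ q ∈ (H' : Set E) ∩ Metric.ball q₀ r, ∀ H ∈ D, q ∈ H → H = H' := by
    by_contra! hcon
    have hsub : (H' : Set E) ∩ Metric.ball q₀ r ⊆ ⋃ H ∈ D \ {H'}, (H : Set E) := by
      intro q hq
      obtain ⟨H, h1, h2, h3⟩ := hcon q hq
      exact mem_biUnion (show H ∈ D \ {H'} from ⟨h1, h3⟩) h2
    obtain ⟨H, hHD, hHs⟩ := (H'.convex.inter (convex_ball q₀ r)).exists_subset_of_subset_biUnion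
      ⟨q₀, hσH' hq₀, Metric.mem_ball_self hr⟩ (hDfin.subset sdiff_subset) hsub
    have hle := AffineSubspace.le_of_inter_ball_subset (hσH' hq₀) hr hHs
    exact hHD.2 (hH.eq_of_le hle hHD.1.2).symm
  have hqσ : q ∈ σ := hq₀r hqV
  -- The point `q`, not `p`, witnesses ordinariness: near it the simplex fills the flat, and no
  -- other flat of dimension at most `k` comes close.
  obtain ⟨ε₃, hε₃, hfar'⟩ := exists_ball_forall_mem_of_mem hC.finite hclosed q
  set U := Metric.ball p ε ∩ Metric.ball q₀ r ∩ Metric.ball q ε₃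
  have hUo : IsOpen U := (Metric.isOpen_ball.inter Metric.isOpen_ball).inter Metric.isOpen_ball
  have hqU : q ∈ U := ⟨⟨(hσ hqσ).2, hqV.2⟩, Metric.mem_ball_self hε₃⟩
  have hSU : S ∩ U = (H' : Set E) ∩ U := by
    ext x
    constructor
    · rintro ⟨hxS, hxU⟩
      refine ⟨?_, hxU⟩
      obtain ⟨H, hHD, hxH⟩ := hcov x ⟨hxS, hxU.1.1⟩
      obtain rfl := hq H hHD (hfar' x hxU.2 H hHD.1 hxH)
      exact hxH
    · rintro ⟨hxH, hxU⟩
      exact ⟨(hσ (hq₀r ⟨hxH, hxU.1.2⟩)).1, hxU⟩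
  exact ⟨hH, q, (hσ hqσ).1, hH.localDim_eq hUo hSU hqV.1 hqU, U, hUo, hqU, hSU⟩

/-- An ordinary flat belongs to every finite covering collection. -/
theorem IsOrdinaryFlat.mem_of_coversByLocalDim {S : Set E} {C : Set (AffineSubspace ℝ E)}
    (hC : CoversByLocalDim S C) (hfin : C.Finite) {k : ℕ} {H : AffineSubspace ℝ E}
    (hH : IsOrdinaryFlat k S H) : H ∈ C := by
  obtain ⟨hflat, p, hpS, hpk, U, hUo, hpU, hSU⟩ := hH
  have hpH : p ∈ H := (hSU.subset ⟨hpS, hpU⟩).1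
  obtain ⟨r, hr, hrU⟩ := Metric.isOpen_iff.1 hUo p hpU
  obtain ⟨H', hH', hsub⟩ := (H.convex.inter (convex_ball p r)).exists_subset_of_subset_biUnion
    (C := {H' | H' ∈ C ∧ IsFlat k H'}) ⟨p, hpH, Metric.mem_ball_self hr⟩
    (hfin.subset fun _ h => h.1) (by
      rintro x ⟨hxH, hxr⟩
      have hxS : x ∈ S := (hSU.superset ⟨hxH, hrU hxr⟩).1
      obtain ⟨H', hH', hxH', k', hk', hk'x⟩ := hC x hxS
      rw [hflat.localDim_eq hUo hSU hxH (hrU hxr)] at hk'x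
      obtain rfl : k' = k := by exact_mod_cast hk'x
      exact mem_biUnion (show H' ∈ {H' | H' ∈ C ∧ IsFlat k' H'} from ⟨hH', hk'⟩) hxH')
  rw [hflat.eq_of_le (AffineSubspace.le_of_inter_ball_subset hpH hr hsub) hH'.2.2.le]
  exact hH'.left

/-- The `k`-flats of a strong cover are exactly the `k`-ordinary flats. -/
theorem IsStrongCover.setOf_isFlat_eq {S : Set E} {C : Set (AffineSubspace ℝ E)}
    (hC : IsStrongCover S C) (k : ℕ) :
    {H | H ∈ C ∧ IsFlat k H} = {H | IsOrdinaryFlat k S H} := by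
  ext H
  exact ⟨fun h => hC.isOrdinaryFlat h.1 h.2,
    fun h => ⟨h.mem_of_coversByLocalDim hC.covers hC.finite, h.1⟩⟩

/-- A finite union of closed convex sets has a strong cover. -/
theorem exists_isStrongCover_iUnion {ι : Type*} [Finite ι] {F : ι → Set E}
    (hclosed : ∀ a, IsClosed (F a)) (hconv : ∀ a, Convex ℝ (F a)) :
    ∃ C, IsStrongCover (⋃ a, F a) C := by
  set C := (fun a => affineSpan ℝ (F a)) '' {a | (F a).Nonempty} with hCdef
  have hfin : C.Finite := (toFinite _).image _
  suffices h : CoversByLocalDim (⋃ a, F a) C by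
    obtain ⟨C', -, hC'⟩ := h.exists_isStrongCover hfin (by
      rintro _ ⟨a, ha, rfl⟩
      exact (affineSpan_nonempty ℝ).2 ha)
    exact ⟨C', hC'⟩
  intro p hp
  set I := {a | p ∈ F a} with hI
  -- Only the pieces through `p` matter near `p`, so the local dimension is the largest dimension
  -- among them.
  obtain ⟨a, haI, hamax⟩ := exists_max_image I
    (fun a => Module.finrank ℝ (affineSpan ℝ (F a)).direction) (toFinite _) (mem_iUnion.1 hp)
  have hane : (F a).Nonempty := ⟨p, haI⟩
  refine ⟨affineSpan ℝ (F a), mem_image_of_mem _ hane, subset_affineSpan ℝ _ haI, _,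
    ⟨(affineSpan_nonempty ℝ).2 hane, rfl⟩, ?_⟩
  obtain ⟨ε₁, hε₁, hfar⟩ := exists_ball_forall_mem_of_mem (toFinite univ)
    (fun a _ => hclosed a) p
  obtain ⟨ε₂, hε₂, hflat⟩ := exists_forall_flatDim_eq (⋃ a, F a) p
  have hε : 0 < min ε₁ ε₂ := by positivity
  rw [← hflat _ hε (min_le_right _ _)]
  apply le_antisymm
  · refine (((hconv a).includesSimplex_inter_ball haI hε).mono ?_).le_flatDim
    exact inter_subset_inter_left _ (subset_iUnion F a)
  · refine (includesSimplex_flatDim _).le_of_subset_biUnion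
      (C := (fun a => affineSpan ℝ (F a)) '' I) ((toFinite _).image _) ?_ (by omega) ?_
    · rintro x ⟨hx, hxε⟩
      obtain ⟨b, hb⟩ := mem_iUnion.1 hx
      have hpb := hfar x (Metric.ball_subset_ball (min_le_left _ _) hxε) b (mem_univ _) hb
      exact mem_biUnion (mem_image_of_mem _ hpb) (subset_affineSpan ℝ _ hb)
    · rintro _ ⟨b, hb, rfl⟩
      exact_mod_cast hamax b hb

end StrongCovers

/-! ### Touching convex sets, and the upper bound by the touching graph. -/

section Touching

variable {E : Type*} [NormedAddCommGroup E] [NormedSpace ℝ E]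

/-- The affine hyperplane `{x | φ x = c}`. -/
def hyperplane (φ : E →L[ℝ] ℝ) (c : ℝ) : AffineSubspace ℝ E where
  carrier := {x | φ x = c}
  smul_vsub_vadd_mem' := by
    intro t x y z hx hy hz
    simp only [mem_ofPred_eq] at *
    simp [hx, hy, hz]

theorem mem_hyperplane {φ : E →L[ℝ] ℝ} {c : ℝ} {x : E} : x ∈ hyperplane φ c ↔ φ x = c := Iff.rfl

theorem exists_apply_eq_of_ne_zero {φ : E →L[ℝ] ℝ} (hφ : φ ≠ 0) (c : ℝ) : ∃ x, φ x = c := by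
  obtain ⟨z, hz⟩ : ∃ z, φ z ≠ 0 := by
    by_contra! h
    exact hφ (ContinuousLinearMap.ext h)
  exact ⟨(c / φ z) • z, by simp [hz]⟩

theorem isFlat_hyperplane [FiniteDimensional ℝ E] {φ : E →L[ℝ] ℝ} (hφ : φ ≠ 0) (c : ℝ) :
    IsFlat (Module.finrank ℝ E - 1) (hyperplane φ c) := by
  obtain ⟨p, hp⟩ := exists_apply_eq_of_ne_zero hφ c
  refine ⟨⟨p, hp⟩, ?_⟩
  have hdir : (hyperplane φ c).direction = LinearMap.ker (φ : E →ₗ[ℝ] ℝ) := by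
    ext v
    rw [← AffineSubspace.vadd_mem_iff_mem_direction v (mem_hyperplane.2 hp), mem_hyperplane]
    simp [hp]
  have hφ' : (φ : E →ₗ[ℝ] ℝ) ≠ 0 := fun h => hφ (ContinuousLinearMap.coe_injective h)
  rw [hdir]
  have := Module.Dual.finrank_ker_add_one_of_ne_zero (f := (φ : E →ₗ[ℝ] ℝ)) hφ'
  omega

theorem IsFlat.exists_eq_hyperplane [FiniteDimensional ℝ E] {k : ℕ} {H : AffineSubspace ℝ E}
    (hH : IsFlat k H) (hk : k + 1 = Module.finrank ℝ E) :
    ∃ (φ : E →L[ℝ] ℝ) (c : ℝ), φ ≠ 0 ∧ H = hyperplane φ c := by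
  obtain ⟨p, hp⟩ := hH.1
  have hlt : H.direction < ⊤ := by
    apply Submodule.lt_top_of_finrank_lt_finrank
    rw [hH.2]; omega
  obtain ⟨f, hf0, hf⟩ := H.direction.exists_le_ker_of_lt_top hlt
  have hφ : LinearMap.toContinuousLinearMap f ≠ 0 := by simpa using hf0
  refine ⟨LinearMap.toContinuousLinearMap f, f p, hφ, hH.eq_of_le ?_ ?_⟩
  · intro x hx
    have : f (x - p) = 0 := hf (AffineSubspace.vsub_mem_direction hx hp)
    rw [map_sub, sub_eq_zero] at this
    exact this
  · rw [(isFlat_hyperplane hφ _).2]; omega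

/-- The sets `A` and `B` lie on either side of the hyperplane `{φ = c}` and contain the two open
halves of the ball of radius `r` around the point `x` of that hyperplane. -/
structure TouchAlong (A B : Set E) (φ : E →L[ℝ] ℝ) (c : ℝ) (x : E) (r : ℝ) : Prop where
  ne_zero : φ ≠ 0
  pos : 0 < r
  apply_eq : φ x = c
  left : ∀ y ∈ Metric.ball x r, c < φ y → y ∈ A
  right : ∀ y ∈ Metric.ball x r, φ y < c → y ∈ B
  le : ∀ y ∈ A, c ≤ φ y
  ge : ∀ y ∈ B, φ y ≤ c

/-- The sets `A` and `B` touch along a piece of the hyperplane `H`, which separates them. -/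
def Touch (A B : Set E) (H : AffineSubspace ℝ E) : Prop :=
  ∃ φ c x r, H = hyperplane φ c ∧ TouchAlong A B φ c x r

theorem TouchAlong.symm {A B : Set E} {φ : E →L[ℝ] ℝ} {c : ℝ} {x : E} {r : ℝ}
    (h : TouchAlong A B φ c x r) : TouchAlong B A (-φ) (-c) x r where
  ne_zero := neg_ne_zero.2 h.ne_zero
  pos := h.pos
  apply_eq := by simp [h.apply_eq]
  left y hy hc := h.right y hy (by simpa using hc)
  right y hy hc := h.left y hy (by simpa using hc)
  le y hy := by simpa using h.ge y hy
  ge y hy := by simpa using h.le y hy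

theorem Touch.symm {A B : Set E} {H : AffineSubspace ℝ E} (h : Touch A B H) : Touch B A H := by
  obtain ⟨φ, c, x, r, rfl, h⟩ := h
  refine ⟨-φ, -c, x, r, ?_, h.symm⟩
  ext y
  simp [mem_hyperplane]

/-- Every point on the wall is a limit of points on its positive side. -/
theorem frequently_lt_apply {φ : E →L[ℝ] ℝ} (hφ : φ ≠ 0) {c : ℝ} {y : E} (hy : φ y = c) :
    ∃ᶠ z in 𝓝 y, c < φ z := by
  obtain ⟨w, hw⟩ := exists_apply_eq_of_ne_zero hφ 1
  have hlim : Tendsto (fun t : ℝ => y + t • w) (𝓝[>] 0) (𝓝 y) := by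
    have : Continuous fun t : ℝ => y + t • w := by fun_prop
    simpa using (this.tendsto 0).mono_left nhdsWithin_le_nhds
  refine hlim.frequently (Eventually.frequently ?_)
  filter_upwards [self_mem_nhdsWithin] with t ht
  have : (0 : ℝ) < t := ht
  simp [hy, hw, this]

theorem TouchAlong.inter_ball_subset_closure {A B : Set E} {φ : E →L[ℝ] ℝ} {c : ℝ} {x : E} {r : ℝ}
    (h : TouchAlong A B φ c x r) :
    (hyperplane φ c : Set E) ∩ Metric.ball x r ⊆ closure A := by
  rintro y ⟨hy, hyr⟩
  rw [mem_closure_iff_frequently]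
  have hb : ∀ᶠ z in 𝓝 y, z ∈ Metric.ball x r := Metric.isOpen_ball.mem_nhds hyr
  exact ((frequently_lt_apply h.ne_zero hy).and_eventually hb).mono fun z hz => h.left z hz.2 hz.1

theorem TouchAlong.closure_subset {A B : Set E} {φ : E →L[ℝ] ℝ} {c : ℝ} {x : E} {r : ℝ}
    (h : TouchAlong A B φ c x r) : closure A ⊆ {y | c ≤ φ y} :=
  closure_minimal h.le (isClosed_le continuous_const φ.continuous)

/-- Two sets touch along at most one hyperplane. -/
theorem Touch.unique [FiniteDimensional ℝ E] {A B : Set E} {H H' : AffineSubspace ℝ E}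
    (h : Touch A B H) (h' : Touch A B H') : H = H' := by
  obtain ⟨φ, c, x, r, rfl, h⟩ := h
  obtain ⟨φ', c', x', r', rfl, h'⟩ := h'
  refine (isFlat_hyperplane h.ne_zero c).eq_of_le ?_ (isFlat_hyperplane h'.ne_zero c').2.le
  refine AffineSubspace.le_of_inter_ball_subset (mem_hyperplane.2 h.apply_eq) h.pos ?_
  -- The first wall piece lies in the closures of both sets, hence weakly on both sides of the
  -- second wall.
  intro y hy
  have h1 : c' ≤ φ' y := h'.closure_subset (h.inter_ball_subset_closure hy)
  have h2 := h'.symm.closure_subset (h.symm.inter_ball_subset_closure ⟨?_, hy.2⟩)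
  · simp only [mem_ofPred_eq, neg_apply, neg_le_neg_iff] at h2
    exact le_antisymm h2 h1
  · have := hy.1
    simp only [SetLike.mem_coe, mem_hyperplane] at this ⊢
    simp [this]

/-- The graph on the indices of a family of sets in which touching sets are joined. -/
def touchGraph {ι : Type*} (K : ι → Set E) : SimpleGraph ι where
  Adj i j := i ≠ j ∧ ∃ H, Touch (K i) (K j) H
  symm := ⟨fun _ _ h => ⟨h.1.symm, h.2.imp fun _ h => h.symm⟩⟩
  loopless := ⟨fun _ h => h.1 rfl⟩

/-- A convex set that contains half of a ball around a point outside of it lies on the side of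
that half. -/
theorem Convex.le_apply_of_half_ball_subset {A : Set E} (hA : Convex ℝ A) {φ : E →L[ℝ] ℝ} {c : ℝ}
    {x : E} (hx : φ x = c) (hxA : x ∉ A) {r : ℝ} (hr : 0 < r)
    (h : ∀ y ∈ Metric.ball x r, c < φ y → y ∈ A) : ∀ y ∈ A, c ≤ φ y := by
  intro z hz
  by_contra! hzc
  -- Prolonging the segment from `z` through `x` slightly enters the half-ball, which puts `x`
  -- between two points of `A`.
  have hlim : Tendsto (fun t : ℝ => x + t • (x - z)) (𝓝[>] 0) (𝓝 x) := by
    have : Continuous fun t : ℝ => x + t • (x - z) := by fun_prop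
    simpa using (this.tendsto 0).mono_left nhdsWithin_le_nhds
  obtain ⟨t, ht, ht0⟩ := ((hlim.eventually (Metric.ball_mem_nhds x hr)).and
    self_mem_nhdsWithin).exists
  have ht0 : (0 : ℝ) < t := ht0
  have hy : x + t • (x - z) ∈ A := by
    refine h _ ht ?_
    simp only [map_add, map_smul, map_sub, hx, smul_eq_mul]
    nlinarith
  apply hxA
  have := hA hy hz (a := (1 + t)⁻¹) (b := (1 + t)⁻¹ * t) (by positivity) (by positivity)
    (by field_simp)
  convert this using 1
  match_scalars <;> field_simp
  ring

variable [FiniteDimensional ℝ E]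

/-- If a convex set accumulates on a relatively open piece of a hyperplane, from its positive
side, then it contains half of a small ball around any point of that piece. -/
theorem Convex.exists_half_ball_subset {A : Set E} (hA : Convex ℝ A) (hne : A.Nonempty)
    {φ : E →L[ℝ] ℝ} {c : ℝ} (hpos : ∀ y ∈ A, c < φ y) {x : E} (hx : φ x = c) {r : ℝ} (hr : 0 < r)
    (hcl : (hyperplane φ c : Set E) ∩ Metric.ball x r ⊆ closure A) :
    ∃ s > 0, ∀ y ∈ Metric.ball x s, c < φ y → y ∈ A := by
  obtain ⟨a, ha⟩ := hne
  have haφ := hpos a ha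
  have hφ : φ ≠ 0 := by
    rintro rfl
    simp at hx haφ
    linarith
  have hint : (interior A).Nonempty := by
    rw [hA.interior_nonempty_iff_affineSpan_eq_top]
    have hsub : closure A ⊆ (affineSpan ℝ A : Set E) :=
      closure_minimal (subset_affineSpan ℝ A) (affineSpan ℝ A).closed_of_finiteDimensional
    have hle : hyperplane φ c ≤ affineSpan ℝ A :=
      AffineSubspace.le_of_inter_ball_subset (mem_hyperplane.2 hx) hr (hcl.trans hsub)
    rw [eq_top_iff]
    intro z _
    have ha' : a ∈ affineSpan ℝ A := subset_affineSpan ℝ A ha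
    have hx' : x ∈ affineSpan ℝ A := hle hx
    set t := (φ z - c) / (φ a - c) with ht
    have hw : z - t • (a - x) ∈ affineSpan ℝ A := by
      apply hle
      rw [mem_hyperplane]
      have : φ a - c ≠ 0 := by linarith
      simp only [map_sub, map_smul, smul_eq_mul, hx, ht]
      field_simp
      ring
    have := AffineSubspace.smul_vsub_vadd_mem _ t ha' hx' hw
    simpa using this
  -- Central projection from `a` onto the hyperplane: `y` is a convex combination of `f y` and `a`
  -- when it is close to `x` on the positive side.
  set f : E → E := fun y =>
    (1 - (φ y - c) / (φ a - c))⁻¹ • (y - ((φ y - c) / (φ a - c)) • a) with hf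
  have hfx : f x = x := by simp [hf, hx]
  have hcont : ContinuousAt f x := by
    have hc1 : ContinuousAt (fun y => (φ y - c) / (φ a - c)) x := by fun_prop
    refine ContinuousAt.smul ((continuousAt_const.sub hc1).inv₀ (by simp [hx])) ?_
    exact continuousAt_id.sub (hc1.smul continuousAt_const)
  have hnear : ∀ᶠ y in 𝓝 x, f y ∈ Metric.ball x r ∧ (φ y - c) / (φ a - c) < 1 := by
    refine (hcont.eventually (by rw [hfx]; exact Metric.ball_mem_nhds x hr)).and ?_
    have hc1 : ContinuousAt (fun y => (φ y - c) / (φ a - c)) x := by fun_prop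
    exact hc1.eventually_lt continuousAt_const (by simp [hx])
  obtain ⟨s, hs, hball⟩ := Metric.mem_nhds_iff.1 hnear
  refine ⟨s, hs, ?_⟩
  have hcl' : ∀ y ∈ Metric.ball x s ∩ {y | c < φ y}, y ∈ closure A := by
    rintro y ⟨hys, hyc⟩
    obtain ⟨h1, h2⟩ := hball hys
    have hd : φ a - c ≠ 0 := by linarith
    have hfy : f y ∈ closure A := by
      refine hcl ⟨?_, h1⟩
      simp only [SetLike.mem_coe, mem_hyperplane, hf, map_smul, map_sub, smul_eq_mul]
      rw [inv_mul_eq_iff_eq_mul₀ (by linarith)]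
      field_simp
      ring
    have hyc' : c < φ y := hyc
    have hτ : 0 ≤ (φ y - c) / (φ a - c) := div_nonneg (by linarith) (by linarith)
    have hmem := hA.closure hfy (subset_closure ha) (sub_nonneg.2 h2.le) hτ (by ring)
    convert hmem using 1
    simp only [hf]
    rw [smul_inv_smul₀ (by linarith), sub_add_cancel]
  have hopen : IsOpen (Metric.ball x s ∩ {y | c < φ y}) :=
    Metric.isOpen_ball.inter (isOpen_lt continuous_const φ.continuous)
  -- An open subset of the closure of a convex set with interior points lies in the set.
  intro y hy hyc
  have := interior_maximal hcl' hopen ⟨hy, hyc⟩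
  rw [hA.interior_closure_eq_interior_of_nonempty_interior hint] at this
  exact interior_subset this

/-- If finitely many convex sets cover one half of a ball, then one of them contains one half
of a smaller ball with centre on the same hyperplane. -/
theorem exists_half_ball_subset_of_cover {ι : Type*} [Finite ι] {K : ι → Set E}
    (hK : ∀ i, Convex ℝ (K i)) {φ : E →L[ℝ] ℝ} (hφ : φ ≠ 0) {c : ℝ} {p : E} (hp : φ p = c) {r : ℝ}
    (hr : 0 < r) (hcov : ∀ y ∈ Metric.ball p r, c < φ y → ∃ i, y ∈ K i) :
    ∃ i x s, 0 < s ∧ φ x = c ∧ Metric.ball x s ⊆ Metric.ball p r ∧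
      ∀ y ∈ Metric.ball x s, c < φ y → y ∈ K i := by
  set A : ι → Set E := fun i => K i ∩ {y | c < φ y}
  have hAconv : ∀ i, Convex ℝ (A i) := fun i =>
    (hK i).inter (convex_halfSpace_gt φ.isBoundedLinearMap.toIsLinearMap c)
  -- The traces on the wall of the closures of the positive parts cover a piece of the wall, so one
  -- of them spans it; `x` is taken in the relative interior of that trace.
  set F : ι → Set E := fun i => closure (A i) ∩ ((hyperplane φ c : Set E) ∩ Metric.ball p r)
  have hFconv : ∀ i, Convex ℝ (F i) := fun i =>
    (hAconv i).closure.inter ((hyperplane φ c).convex.inter (convex_ball p r))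
  have hpH : p ∈ hyperplane φ c := hp
  have hsub : (hyperplane φ c : Set E) ∩ Metric.ball p r ⊆
      ⋃ H ∈ range (fun i => affineSpan ℝ (F i)), (H : Set E) := by
    rintro y ⟨hy, hyr⟩
    have hb : ∀ᶠ z in 𝓝 y, z ∈ Metric.ball p r := Metric.isOpen_ball.mem_nhds hyr
    have hfreq : ∃ᶠ z in 𝓝 y, ∃ i, z ∈ A i :=
      ((frequently_lt_apply hφ hy).and_eventually hb).mono fun z hz => by
        obtain ⟨i, hi⟩ := hcov z hz.2 hz.1
        exact ⟨i, hi, hz.1⟩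
    obtain ⟨i, hi⟩ : ∃ i, y ∈ closure (A i) := by
      have : y ∈ closure (⋃ i, A i) := by
        rw [mem_closure_iff_frequently]
        simpa using hfreq
      rw [closure_iUnion_of_finite] at this
      exact mem_iUnion.1 this
    exact mem_biUnion (mem_range_self i) (subset_affineSpan ℝ _ ⟨hi, hy, hyr⟩)
  obtain ⟨_, ⟨i, rfl⟩, hi⟩ := ((hyperplane φ c).convex.inter
    (convex_ball p r)).exists_subset_of_subset_biUnion ⟨p, hpH, Metric.mem_ball_self hr⟩
    (finite_range _) hsub
  have hle : hyperplane φ c ≤ affineSpan ℝ (F i) :=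
    AffineSubspace.le_of_inter_ball_subset hpH hr hi
  have hFne : (F i).Nonempty := (affineSpan_nonempty ℝ).1 ⟨p, hle hpH⟩
  obtain ⟨x, hxF, ρ, hρ, hxρ⟩ := (hFconv i).exists_affineSpan_inter_ball_subset hFne
  have hAne : (A i).Nonempty := closure_nonempty_iff.1 ⟨x, hxF.1⟩
  obtain ⟨s, hs, hsA⟩ := (hAconv i).exists_half_ball_subset hAne (fun y hy => hy.2) hxF.2.1 hρ
    (fun y hy => (hxρ ⟨hle hy.1, hy.2⟩).1)
  obtain ⟨s', hs', hs'p⟩ := Metric.isOpen_iff.1 Metric.isOpen_ball x hxF.2.2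
  refine ⟨i, x, min s s', by positivity, hxF.2.1,
    (Metric.ball_subset_ball (min_le_right _ _)).trans hs'p, fun y hy hyc => ?_⟩
  exact (hsA y (Metric.ball_subset_ball (min_le_left _ _) hy) hyc).1

/-- Along an ordinary hyperplane of the complement of a union of convex sets, two of these sets
touch. -/
theorem IsOrdinaryFlat.exists_touch {ι : Type*} [Finite ι] {K : ι → Set E}
    (hK : ∀ i, Convex ℝ (K i)) {k : ℕ} (hk : k + 1 = Module.finrank ℝ E) {H : AffineSubspace ℝ E}
    (hH : IsOrdinaryFlat k (⋃ i, K i)ᶜ H) : ∃ i j, i ≠ j ∧ Touch (K i) (K j) H := by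
  obtain ⟨hflat, p, hpS, -, U, hUo, hpU, hSU⟩ := hH
  obtain ⟨φ, c, hφ, rfl⟩ := hflat.exists_eq_hyperplane hk
  have hp : φ p = c := (hSU.subset ⟨hpS, hpU⟩).1
  obtain ⟨r, hr, hrU⟩ := Metric.isOpen_iff.1 hUo p hpU
  have hcov : ∀ y ∈ Metric.ball p r, φ y ≠ c → ∃ i, y ∈ K i := by
    intro y hy hyc
    by_contra! hno
    exact hyc (hSU.subset ⟨by simpa using hno, hrU hy⟩).1
  have hdisj : ∀ y ∈ Metric.ball p r, φ y = c → ∀ i, y ∉ K i := by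
    intro y hy hyc i hi
    exact (hSU.superset ⟨hyc, hrU hy⟩).1 (mem_iUnion.2 ⟨i, hi⟩)
  obtain ⟨i, x, s, hs, hx, hsub, hi⟩ := exists_half_ball_subset_of_cover hK hφ hp hr
    -- The negative side is treated within the ball just found, so that `K i` still contains the
    -- positive half of the final ball and both half-balls share the centre `x'`.
    (fun y hy hyc => hcov y hy hyc.ne')
  obtain ⟨j, x', s', hs', hx', hsub', hj⟩ := exists_half_ball_subset_of_cover hK
    (neg_ne_zero.2 hφ) (c := -c) (p := x) (by simp [hx]) hs
    (fun y hy hyc => hcov y (hsub hy) (by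
      simp only [neg_apply, neg_lt_neg_iff] at hyc
      exact hyc.ne))
  have hx'c : φ x' = c := by simpa using hx'
  have hx'p : x' ∈ Metric.ball p r := hsub (hsub' (Metric.mem_ball_self hs'))
  have hi' : ∀ y ∈ Metric.ball x' s', c < φ y → y ∈ K i := fun y hy => hi y (hsub' hy)
  have hT : TouchAlong (K i) (K j) φ c x' s' :=
    { ne_zero := hφ
      pos := hs'
      apply_eq := hx'c
      left := hi'
      right := fun y hy hyc => hj y hy (by simpa using hyc)
      le := (hK i).le_apply_of_half_ball_subset hx'c (hdisj x' hx'p hx'c i) hs' hi'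
      ge := fun y hy => by
        simpa using (hK j).le_apply_of_half_ball_subset hx' (hdisj x' hx'p hx'c j) hs' hj y hy }
  refine ⟨i, j, ?_, φ, c, x', s', rfl, hT⟩
  rintro rfl
  have hb : ∀ᶠ z in 𝓝 x', z ∈ Metric.ball x' s' := Metric.ball_mem_nhds x' hs'
  obtain ⟨z, hz, hzb⟩ := ((frequently_lt_apply hφ hx'c).and_eventually hb).exists
  exact absurd (hT.ge z (hi' z hzb hz)) (not_le.2 hz)

/-- The complement of a union of convex sets has at most as many ordinary hyperplanes as there
are pairs of touching sets. -/
theorem encard_isOrdinaryFlat_le {ι : Type*} [Finite ι] {K : ι → Set E}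
    (hK : ∀ i, Convex ℝ (K i)) {k : ℕ} (hk : k + 1 = Module.finrank ℝ E) :
    {H | IsOrdinaryFlat k (⋃ i, K i)ᶜ H}.encard ≤ (touchGraph K).edgeSet.encard := by
  have key : ∀ H ∈ {H | IsOrdinaryFlat k (⋃ i, K i)ᶜ H},
      ∃ e : Sym2 ι, ∃ i j, e = s(i, j) ∧ i ≠ j ∧ Touch (K i) (K j) H := by
    intro H hH
    obtain ⟨i, j, hij, h⟩ := IsOrdinaryFlat.exists_touch hK hk hH
    exact ⟨s(i, j), i, j, rfl, hij, h⟩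
  rcases isEmpty_or_nonempty ι with hι | hι
  · have hempty : {H | IsOrdinaryFlat k (⋃ i, K i)ᶜ H} = ∅ :=
      eq_empty_of_forall_notMem fun H hH => by
        obtain ⟨-, i, -⟩ := key H hH
        exact isEmptyElim i
    rw [hempty, encard_empty]
    exact zero_le
  have : Nonempty (Sym2 ι) := hι.map Sym2.diag
  choose! f hf using key
  refine encard_le_encard_of_injOn (f := f) ?_ ?_
  · intro H hH
    obtain ⟨i, j, he, hij, h⟩ := hf H hH
    rw [he]
    exact ⟨hij, H, h⟩
  · intro H hH H' hH' hHH'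
    obtain ⟨i, j, he, hij, h⟩ := hf H hH
    obtain ⟨i', j', he', hij', h'⟩ := hf H' hH'
    rw [he, he', Sym2.eq_iff] at hHH'
    rcases hHH' with ⟨rfl, rfl⟩ | ⟨rfl, rfl⟩
    · exact h.unique h'
    · exact h.unique h'.symm

end Touching

/-! ### Parity of crossings, from signs of orientations. -/

section Planarity

/-- Twice the signed area of the triangle `abc`. -/
def orient (a b c : EuclideanSpace ℝ (Fin 2)) : ℝ :=
  (b 0 - a 0) * (c 1 - a 1) - (b 1 - a 1) * (c 0 - a 0)

/-- The triangle `abc` is positively oriented. -/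
noncomputable def ccw (a b c : EuclideanSpace ℝ (Fin 2)) : Bool := decide (0 < orient a b c)

/-- For points in general position: the segments `ab` and `cd` cross. -/
noncomputable def segCross (a b c d : EuclideanSpace ℝ (Fin 2)) : Bool :=
  (ccw a b c != ccw a b d) && (ccw a c d != ccw b c d)

/-- For points in general position: the point `x` lies in the triangle `abc`. -/
noncomputable def inTriangle (a b c x : EuclideanSpace ℝ (Fin 2)) : Bool :=
  (ccw a b x == ccw b c x) && (ccw b c x != ccw a c x)

theorem ccw_swap_left {a b c : EuclideanSpace ℝ (Fin 2)} (h : orient a b c ≠ 0) :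
    ccw b a c = !ccw a b c := by
  have : orient b a c = -orient a b c := by simp only [orient]; ring
  rcases h.lt_or_gt with h | h <;> simp [ccw, this, h, h.le]

theorem ccw_rotate (a b c : EuclideanSpace ℝ (Fin 2)) : ccw b c a = ccw a b c := by
  have : orient b c a = orient a b c := by simp only [orient]; ring
  simp [ccw, this]

theorem ccw_swap_right {a b c : EuclideanSpace ℝ (Fin 2)} (h : orient a b c ≠ 0) :
    ccw a c b = !ccw a b c := by
  rw [← ccw_swap_left h, ccw_rotate b a c]

theorem segCross_comm (a b c d : EuclideanSpace ℝ (Fin 2)) :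
    segCross c d a b = segCross a b c d := by
  simp only [segCross]
  rw [ccw_rotate a c d, ccw_rotate b c d, ← ccw_rotate c a b, ← ccw_rotate d a b, Bool.and_comm]

/-- Points whose segments cross in the combinatorial sense have a common point. -/
theorem nonempty_inter_of_segCross {a b c d : EuclideanSpace ℝ (Fin 2)} (h₁ : orient a b c ≠ 0)
    (h₂ : orient a b d ≠ 0) (h₃ : orient a c d ≠ 0) (h₄ : orient b c d ≠ 0)
    (h : segCross a b c d = true) : (segment ℝ a b ∩ segment ℝ c d).Nonempty := by
  -- opposite signs give a point of the segment on the line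
  have key : ∀ {u v : ℝ}, u ≠ 0 → v ≠ 0 → (decide (0 < u) != decide (0 < v)) = true →
      u - v ≠ 0 ∧ 0 ≤ u / (u - v) ∧ u / (u - v) ≤ 1 := by
    intro u v hu hv huv
    rcases hu.lt_or_gt with hu | hu <;> rcases hv.lt_or_gt with hv | hv <;>
      simp [hu, hv, not_lt.2 hu.le, not_lt.2 hv.le] at huv
    · exact ⟨by linarith, div_nonneg_of_nonpos hu.le (by linarith),
        div_le_one_of_ge (by linarith) (by linarith)⟩
    · exact ⟨by linarith, div_nonneg hu.le (by linarith),
        div_le_one_of_le₀ (by linarith) (by linarith)⟩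
  simp only [segCross, Bool.and_eq_true] at h
  obtain ⟨hd₁, hs₀, hs₁⟩ := key h₁ h₂ h.1
  obtain ⟨hd₂, ht₀, ht₁⟩ := key h₃ h₄ h.2
  -- The point of the line `ab` at which the affine function `orient · c d` vanishes.
  refine ⟨AffineMap.lineMap a b (orient a c d / (orient a c d - orient b c d)), ?_, ?_⟩
  · rw [segment_eq_image_lineMap]
    exact mem_image_of_mem _ ⟨ht₀, ht₁⟩
  · rw [segment_eq_image_lineMap]
    refine ⟨orient a b c / (orient a b c - orient a b d), ⟨hs₀, hs₁⟩, ?_⟩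
    have hd : orient a c d - orient b c d = -(orient a b c - orient a b d) := by
      simp only [orient]; ring
    rw [hd]
    ext i
    simp only [AffineMap.lineMap_apply_module, PiLp.add_apply, PiLp.smul_apply, smul_eq_mul]
    field_simp
    fin_cases i <;> simp only [orient, Fin.zero_eta, Fin.mk_one, Fin.isValue] <;> ring

/-- The sign condition imposed by a three-term relation `u₁ u₂ - u₃ u₄ + u₅ u₆ = 0`. -/
def PluckerSigns (s₁ s₂ s₃ s₄ s₅ s₆ : Bool) : Prop :=
  (s₁ == s₂) = (s₅ == s₆) → (s₃ == s₄) = (s₁ == s₂)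

instance (s₁ s₂ s₃ s₄ s₅ s₆ : Bool) : Decidable (PluckerSigns s₁ s₂ s₃ s₄ s₅ s₆) :=
  inferInstanceAs (Decidable (_ → _))

theorem pluckerSigns_of_eq_zero {u₁ u₂ u₃ u₄ u₅ u₆ : ℝ} (h : u₁ * u₂ - u₃ * u₄ + u₅ * u₆ = 0)
    (h₁ : u₁ ≠ 0) (h₂ : u₂ ≠ 0) (h₃ : u₃ ≠ 0) (h₄ : u₄ ≠ 0) (h₅ : u₅ ≠ 0) (h₆ : u₆ ≠ 0) :
    PluckerSigns (decide (0 < u₁)) (decide (0 < u₂)) (decide (0 < u₃)) (decide (0 < u₄))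
      (decide (0 < u₅)) (decide (0 < u₆)) := by
  have key : ∀ {u v : ℝ}, u ≠ 0 → v ≠ 0 →
      (decide (0 < u) == decide (0 < v)) = decide (0 < u * v) := by
    intro u v hu hv
    rcases hu.lt_or_gt with hu | hu <;> rcases hv.lt_or_gt with hv | hv
    · simp [not_lt.2 hu.le, not_lt.2 hv.le, mul_pos_of_neg_of_neg hu hv]
    · simp [not_lt.2 hu.le, hv]
    · simp [hu, not_lt.2 hv.le]
    · simp [hu, hv]
  unfold PluckerSigns
  rw [key h₁ h₂, key h₃ h₄, key h₅ h₆]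
  have h12 := mul_ne_zero h₁ h₂
  have h34 := mul_ne_zero h₃ h₄
  have h56 := mul_ne_zero h₅ h₆
  generalize u₁ * u₂ = x at *
  generalize u₃ * u₄ = y at *
  generalize u₅ * u₆ = z at *
  intro hxz
  simp only [decide_eq_decide] at hxz ⊢
  rcases h12.lt_or_gt with hx | hx <;> rcases h56.lt_or_gt with hz | hz
  · exact iff_of_false (by linarith) (by linarith)
  · exact absurd (hxz.2 hz) (by linarith)
  · exact absurd (hxz.1 hx) (by linarith)
  · exact iff_of_true (by linarith) hx

/-- A family of points of which no three are collinear. -/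
def GeneralPosition {ι : Type*} (P : ι → EuclideanSpace ℝ (Fin 2)) : Prop :=
  ∀ i j k, i ≠ j → i ≠ k → j ≠ k → orient (P i) (P j) (P k) ≠ 0

theorem GeneralPosition.comp {ι κ : Type*} {P : ι → EuclideanSpace ℝ (Fin 2)}
    (h : GeneralPosition P) {f : κ → ι} (hf : Function.Injective f) : GeneralPosition (P ∘ f) :=
  fun _ _ _ hij hik hjk => h _ _ _ (hf.ne hij) (hf.ne hik) (hf.ne hjk)

/-- The five three-term relations between the orientations of five points. -/
theorem GeneralPosition.pluckerSigns {P : Fin 5 → EuclideanSpace ℝ (Fin 2)}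
    (h : GeneralPosition P) :
    let s := fun i j k => ccw (P i) (P j) (P k)
    PluckerSigns (s 0 1 2) (s 0 3 4) (s 0 1 3) (s 0 2 4) (s 0 1 4) (s 0 2 3) ∧
    PluckerSigns (s 0 1 2) (s 1 3 4) (s 0 1 3) (s 1 2 4) (s 0 1 4) (s 1 2 3) ∧
    PluckerSigns (s 0 1 2) (s 2 3 4) (s 0 2 3) (s 1 2 4) (s 0 2 4) (s 1 2 3) ∧
    PluckerSigns (s 0 1 3) (s 2 3 4) (s 0 2 3) (s 1 3 4) (s 0 3 4) (s 1 2 3) ∧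
    PluckerSigns (s 0 1 4) (s 2 3 4) (s 0 2 4) (s 1 3 4) (s 0 3 4) (s 1 2 4) := by
  -- Grassmann–Plücker relations, one for each of the five points as the common index.
  refine ⟨?_, ?_, ?_, ?_, ?_⟩ <;>
  · refine pluckerSigns_of_eq_zero ?_ ?_ ?_ ?_ ?_ ?_ ?_
    · simp only [orient]; ring
    all_goals exact h _ _ _ (by decide) (by decide) (by decide)

/-- Parity for the triangle `abc` and the segment `xy`, checked on all sign patterns obeying the
three-term relations; it stands in for the Jordan curve theorem for triangles. -/
theorem xor_cross_eq_of_pluckerSigns : ∀ abc abx aby acx acy axy bcx bcy bxy cxy : Bool,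
    PluckerSigns abc axy abx acy aby acx → PluckerSigns abc bxy abx bcy aby bcx →
    PluckerSigns abc cxy acx bcy acy bcx → PluckerSigns abx cxy acx bxy axy bcx →
    PluckerSigns aby cxy acy bxy axy bcy →
    (((abx != aby) && (axy != bxy)).toNat + ((bcx != bcy) && (bxy != cxy)).toNat +
      ((acx != acy) && (axy != cxy)).toNat +
      ((abx == bcx) && (bcx != acx)).toNat + ((aby == bcy) && (bcy != acy)).toNat) % 2 = 0 := by
  decide

/-- A segment crosses the boundary of a triangle an odd number of times if and only if exactly one
of its ends lies in the triangle. -/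
theorem GeneralPosition.triangle {P : Fin 5 → EuclideanSpace ℝ (Fin 2)} (h : GeneralPosition P) :
    ((segCross (P 0) (P 1) (P 3) (P 4)).toNat + (segCross (P 1) (P 2) (P 3) (P 4)).toNat +
      (segCross (P 0) (P 2) (P 3) (P 4)).toNat + (inTriangle (P 0) (P 1) (P 2) (P 3)).toNat +
      (inTriangle (P 0) (P 1) (P 2) (P 4)).toNat) % 2 = 0 := by
  obtain ⟨h0, h1, h2, h3, h4⟩ := h.pluckerSigns
  exact xor_cross_eq_of_pluckerSigns _ _ _ _ _ _ _ _ _ _ h0 h1 h2 h3 h4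

/-- The number of crossings among the three pairs of opposite edges of four points. -/
def quadCrossings (abc abd acd bcd : Bool) : ℕ :=
  ((abc != abd) && (acd != bcd)).toNat + (((!abc) != acd) && (abd != !bcd)).toNat +
    (((!abd) != !acd) && (abc != bcd)).toNat

/-- Rewrites the crossings in terms of orientations of increasing triples only, so that five points
involve just ten signs to enumerate. -/
theorem GeneralPosition.quadCrossings_eq {P : Fin 4 → EuclideanSpace ℝ (Fin 2)}
    (h : GeneralPosition P) :
    quadCrossings (ccw (P 0) (P 1) (P 2)) (ccw (P 0) (P 1) (P 3)) (ccw (P 0) (P 2) (P 3))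
      (ccw (P 1) (P 2) (P 3)) =
    (segCross (P 0) (P 1) (P 2) (P 3)).toNat + (segCross (P 0) (P 2) (P 1) (P 3)).toNat +
      (segCross (P 0) (P 3) (P 1) (P 2)).toNat := by
  simp only [segCross, quadCrossings]
  rw [ccw_swap_right (h 0 1 2 (by decide) (by decide) (by decide)),
    ccw_swap_left (h 1 2 3 (by decide) (by decide) (by decide)),
    ccw_swap_right (h 0 1 3 (by decide) (by decide) (by decide)),
    ccw_swap_right (h 0 2 3 (by decide) (by decide) (by decide)),
    ← ccw_rotate (P 3) (P 1) (P 2)]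

theorem odd_quadCrossings_of_pluckerSigns : ∀ abc abd abe acd ace ade bcd bce bde cde : Bool,
    PluckerSigns abc ade abd ace abe acd → PluckerSigns abc bde abd bce abe bcd →
    PluckerSigns abc cde acd bce ace bcd → PluckerSigns abd cde acd bde ade bcd →
    PluckerSigns abe cde ace bde ade bce →
    (quadCrossings abc abd acd bcd + quadCrossings abc abe ace bce +
      quadCrossings abd abe ade bde + quadCrossings acd ace ade cde +
      quadCrossings bcd bce bde cde) % 2 = 1 := by
  decide

/-- In the straight-line drawing of the complete graph on five points, the number of crossings
is odd. -/
theorem GeneralPosition.odd_crossings {P : Fin 5 → EuclideanSpace ℝ (Fin 2)}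
    (h : GeneralPosition P) :
    let X := fun i j k l => (segCross (P i) (P j) (P k) (P l)).toNat
    (X 0 1 2 3 + X 0 2 1 3 + X 0 3 1 2 + (X 0 1 2 4 + X 0 2 1 4 + X 0 4 1 2) +
      (X 0 1 3 4 + X 0 3 1 4 + X 0 4 1 3) + (X 0 2 3 4 + X 0 3 2 4 + X 0 4 2 3) +
      (X 1 2 3 4 + X 1 3 2 4 + X 1 4 2 3)) % 2 = 1 := by
  obtain ⟨h0, h1, h2, h3, h4⟩ := h.pluckerSigns
  have key := odd_quadCrossings_of_pluckerSigns _ _ _ _ _ _ _ _ _ _ h0 h1 h2 h3 h4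
  have e0 := (h.comp (f := ![0, 1, 2, 3]) (by decide)).quadCrossings_eq
  have e1 := (h.comp (f := ![0, 1, 2, 4]) (by decide)).quadCrossings_eq
  have e2 := (h.comp (f := ![0, 1, 3, 4]) (by decide)).quadCrossings_eq
  have e3 := (h.comp (f := ![0, 2, 3, 4]) (by decide)).quadCrossings_eq
  have e4 := (h.comp (f := ![1, 2, 3, 4]) (by decide)).quadCrossings_eq
  simp only [Function.comp_apply, Matrix.cons_val] at e0 e1 e2 e3 e4
  rw [e0, e1, e2, e3, e4] at key
  exact key

/-- Replacing the segments `ab` and `cd` by the paths `aqb` and `csd` changes the parity of the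
number of crossings in a way that depends only on the ends. -/
theorem GeneralPosition.bend {P : Fin 6 → EuclideanSpace ℝ (Fin 2)} (h : GeneralPosition P) :
    ((segCross (P 0) (P 1) (P 3) (P 4)).toNat + (segCross (P 0) (P 1) (P 4) (P 5)).toNat +
      (segCross (P 1) (P 2) (P 3) (P 4)).toNat + (segCross (P 1) (P 2) (P 4) (P 5)).toNat +
      (segCross (P 0) (P 2) (P 3) (P 5)).toNat +
      (inTriangle (P 0) (P 1) (P 2) (P 3)).toNat + (inTriangle (P 0) (P 1) (P 2) (P 5)).toNat +
      (inTriangle (P 3) (P 4) (P 5) (P 0)).toNat + (inTriangle (P 3) (P 4) (P 5) (P 2)).toNat) % 2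
      = 0 := by
  -- Triangle `012` against the segments `34` and `45`, and triangle `345` against `02`. In the sum,
  -- the crossings of `02` with `34` and `45` and the position of point `4` occur twice and cancel.
  have h1 := (h.comp (f := ![0, 1, 2, 3, 4]) (by decide)).triangle
  have h2 := (h.comp (f := ![0, 1, 2, 4, 5]) (by decide)).triangle
  have h3 := (h.comp (f := ![3, 4, 5, 0, 2]) (by decide)).triangle
  simp only [Function.comp_apply, Matrix.cons_val] at h1 h2 h3
  rw [segCross_comm (P 0) (P 2) (P 3) (P 4), segCross_comm (P 0) (P 2) (P 4) (P 5),
    segCross_comm (P 0) (P 2) (P 3) (P 5)] at h3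
  omega

end Planarity

/-! ### No five convex sets in the plane touch pairwise. -/

section Drawings

/-- A generic small displacement brings finitely many points into general position. -/
theorem eventually_generalPosition {ι : Type*} [Finite ι] (P : ι → EuclideanSpace ℝ (Fin 2))
    {a : ι → ℝ} (ha : Function.Injective a) :
    ∀ᶠ t : ℝ in 𝓝[>] 0, GeneralPosition fun i => P i + t • !₂[a i, a i ^ 2] := by
  simp only [GeneralPosition, eventually_all]
  intro i j k hij hik hjk
  -- Displacing along a parabola makes each orientation a quadratic in `t` whose leading coefficient
  -- is a Vandermonde determinant, so it vanishes for finitely many `t` only.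
  have hA : (a j - a i) * (a k - a i) * (a k - a j) ≠ 0 :=
    mul_ne_zero (mul_ne_zero (sub_ne_zero.2 (ha.ne hij.symm)) (sub_ne_zero.2 (ha.ne hik.symm)))
      (sub_ne_zero.2 (ha.ne hjk.symm))
  set A := (a j - a i) * (a k - a i) * (a k - a j) with hAdef
  set B := (P j 0 - P i 0) * (a k ^ 2 - a i ^ 2) + (a j - a i) * (P k 1 - P i 1) -
    (P j 1 - P i 1) * (a k - a i) - (a j ^ 2 - a i ^ 2) * (P k 0 - P i 0) with hB
  have hpoly : ∀ t : ℝ, orient (P i + t • !₂[a i, a i ^ 2]) (P j + t • !₂[a j, a j ^ 2])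
      (P k + t • !₂[a k, a k ^ 2]) = A * t ^ 2 + B * t + orient (P i) (P j) (P k) := by
    intro t
    simp only [orient, hAdef, hB, PiLp.add_apply, PiLp.smul_apply, smul_eq_mul,
      Matrix.cons_val_zero, Matrix.cons_val_one]
    ring
  simp only [hpoly]
  set p : Polynomial ℝ := Polynomial.C A * Polynomial.X ^ 2 + Polynomial.C B * Polynomial.X +
    Polynomial.C (orient (P i) (P j) (P k)) with hp
  have hp0 : p ≠ 0 := by
    intro h0
    have := Polynomial.natDegree_quadratic (b := B) (c := orient (P i) (P j) (P k)) hA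
    rw [← hp, h0] at this
    simp at this
  have hfin : {t : ℝ | p.IsRoot t}.Finite := Polynomial.finite_setOfPred_isRoot hp0
  have hev : ∀ᶠ t : ℝ in 𝓝[≠] 0, ¬ p.IsRoot t :=
    (hfin.eventually_cofinite_notMem).filter_mono (nhdsNE_le_cofinite 0)
  filter_upwards [hev.filter_mono (nhdsWithin_mono 0 fun t (ht : 0 < t) => ht.ne')] with t ht h0
  apply ht
  simpa [hp, Polynomial.IsRoot] using h0

/-- A segment in an open set stays there under small displacements. -/
theorem eventually_segment_subset {E : Type*} [NormedAddCommGroup E] [NormedSpace ℝ E]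
    {R : Set E} (hR : IsOpen R) {x y : E} (h : segment ℝ x y ⊆ R) (v w : E) :
    ∀ᶠ t : ℝ in 𝓝[>] 0, segment ℝ (x + t • v) (y + t • w) ⊆ R := by
  have hc : Continuous fun z : ℝ × ℝ => AffineMap.lineMap (x + z.1 • v) (y + z.1 • w) z.2 := by
    simp only [AffineMap.lineMap_apply_module]
    fun_prop
  have key : ∀ᶠ t : ℝ in 𝓝 0, ∀ s ∈ Icc (0 : ℝ) 1,
      AffineMap.lineMap (x + t • v) (y + t • w) s ∈ R := by
    refine isCompact_Icc.eventually_forall_of_forall_eventually fun s hs => ?_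
    refine hc.continuousAt.eventually (hR.mem_nhds ?_)
    apply h
    rw [segment_eq_image_lineMap]
    exact ⟨s, hs, by simp⟩
  filter_upwards [key.filter_mono nhdsWithin_le_nhds] with t ht
  rw [segment_eq_image_lineMap]
  rintro _ ⟨s, hs, rfl⟩
  exact ht s hs

theorem GeneralPosition.segCross_eq_false {ι : Type*} {P : ι → EuclideanSpace ℝ (Fin 2)}
    (h : GeneralPosition P) {a b c d : ι}
    (hne : a ≠ b ∧ a ≠ c ∧ a ≠ d ∧ b ≠ c ∧ b ≠ d ∧ c ≠ d) {R R' : Set (EuclideanSpace ℝ (Fin 2))}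
    (hR : R ∩ R' = ∅) (h₁ : segment ℝ (P a) (P b) ⊆ R) (h₂ : segment ℝ (P c) (P d) ⊆ R') :
    segCross (P a) (P b) (P c) (P d) = false := by
  obtain ⟨hab, hac, had, hbc, hbd, hcd⟩ := hne
  rw [Bool.eq_false_iff]
  intro hX
  have := nonempty_inter_of_segCross (h a b c hab hac hbc) (h a b d hab had hbd)
    (h a c d hac had hcd) (h b c d hbc hbd hcd) hX
  exact (this.mono (inter_subset_inter h₁ h₂)).ne_empty hR

/-- If the bent edges `aqb` and `csd` do not meet, the parity of the number of crossings of the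
straight edges depends only on which ends lie in the triangles spanned by the bent edges. -/
theorem GeneralPosition.even_of_inter_eq_empty {P : Fin 6 → EuclideanSpace ℝ (Fin 2)}
    (h : GeneralPosition P) {R R' : Set (EuclideanSpace ℝ (Fin 2))} (hR : R ∩ R' = ∅)
    (h₁ : segment ℝ (P 0) (P 1) ⊆ R) (h₂ : segment ℝ (P 1) (P 2) ⊆ R)
    (h₃ : segment ℝ (P 3) (P 4) ⊆ R') (h₄ : segment ℝ (P 4) (P 5) ⊆ R') :
    ((segCross (P 0) (P 2) (P 3) (P 5)).toNat +
      (inTriangle (P 0) (P 1) (P 2) (P 3)).toNat + (inTriangle (P 0) (P 1) (P 2) (P 5)).toNat +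
      (inTriangle (P 3) (P 4) (P 5) (P 0)).toNat + (inTriangle (P 3) (P 4) (P 5) (P 2)).toNat) % 2
      = 0 := by
  have hb := h.bend
  rw [h.segCross_eq_false (by decide) hR h₁ h₃, h.segCross_eq_false (by decide) hR h₁ h₄,
    h.segCross_eq_false (by decide) hR h₂ h₃, h.segCross_eq_false (by decide) hR h₂ h₄] at hb
  simpa using hb

theorem injective_edgePoints {α : Type*} {i j k l : α}
    (h : i ≠ j ∧ k ≠ l ∧ i ≠ k ∧ i ≠ l ∧ j ≠ k ∧ j ≠ l) :
    Function.Injective ![(i, i), (i, j), (j, j), (k, k), (k, l), (l, l)] := by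
  obtain ⟨hij, hkl, hik, hil, hjk, hjl⟩ := h
  rw [← List.nodup_ofFn]
  simp [List.ofFn_succ, *]

/-- The complete graph on five vertices has no plane drawing whose edges are paths of two segments,
in general position. The vertices are the points `P i i`, and the edge between `i < j` bends
at `P i j`. -/
theorem GeneralPosition.exists_inter_nonempty {P : Fin 5 → Fin 5 → EuclideanSpace ℝ (Fin 2)}
    (h : GeneralPosition fun i : Fin 5 × Fin 5 => P i.1 i.2)
    {R : Fin 5 → Fin 5 → Set (EuclideanSpace ℝ (Fin 2))}
    (hl : ∀ i j, i < j → segment ℝ (P i i) (P i j) ⊆ R i j)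
    (hr : ∀ i j, i < j → segment ℝ (P i j) (P j j) ⊆ R i j) :
    ∃ i j k l, i < j ∧ k < l ∧ i ≠ k ∧ i ≠ l ∧ j ≠ k ∧ j ≠ l ∧ (R i j ∩ R k l).Nonempty := by
  by_contra! hdisj
  have key : ∀ i j k l, i < j ∧ k < l ∧ i ≠ k ∧ i ≠ l ∧ j ≠ k ∧ j ≠ l →
      ((segCross (P i i) (P j j) (P k k) (P l l)).toNat +
        (inTriangle (P i i) (P i j) (P j j) (P k k)).toNat +
        (inTriangle (P i i) (P i j) (P j j) (P l l)).toNat +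
        (inTriangle (P k k) (P k l) (P l l) (P i i)).toNat +
        (inTriangle (P k k) (P k l) (P l l) (P j j)).toNat) % 2 = 0 := by
    rintro i j k l ⟨hij, hkl, hne⟩
    exact (h.comp (injective_edgePoints ⟨hij.ne, hkl.ne, hne⟩)).even_of_inter_eq_empty
      (hdisj i j k l hij hkl hne.1 hne.2.1 hne.2.2.1 hne.2.2.2)
      (hl i j hij) (hr i j hij) (hl k l hkl) (hr k l hkl)
  have hodd :=
    (h.comp (f := fun i : Fin 5 => (i, i)) fun i j hij => by simpa using hij).odd_crossings
  simp only [Function.comp_apply] at hodd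
  have k1 := key 0 1 2 3 (by decide)
  have k2 := key 0 2 1 3 (by decide)
  have k3 := key 0 3 1 2 (by decide)
  have k4 := key 0 1 2 4 (by decide)
  have k5 := key 0 2 1 4 (by decide)
  have k6 := key 0 4 1 2 (by decide)
  have k7 := key 0 1 3 4 (by decide)
  have k8 := key 0 3 1 4 (by decide)
  have k9 := key 0 4 1 3 (by decide)
  have k10 := key 0 2 3 4 (by decide)
  have k11 := key 0 3 2 4 (by decide)
  have k12 := key 0 4 2 3 (by decide)
  have k13 := key 1 2 3 4 (by decide)
  have k14 := key 1 3 2 4 (by decide)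
  have k15 := key 1 4 2 3 (by decide)
  -- Summing the fifteen congruences, the triangle term of an edge `ij` and a vertex `k` occurs
  -- twice, once for each of the other two ends `l` of an edge `kl`. So the crossings are even in
  -- number, against `hodd`.
  omega

/-- The complete graph on five vertices has no plane drawing whose edges are paths of two segments:
two of the open sets `R i j` that contain the edges meet, for some disjoint pairs of vertices. -/
theorem exists_inter_nonempty_of_segment_subset
    {P : Fin 5 → Fin 5 → EuclideanSpace ℝ (Fin 2)}
    {R : Fin 5 → Fin 5 → Set (EuclideanSpace ℝ (Fin 2))} (hR : ∀ i j, IsOpen (R i j))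
    (hl : ∀ i j, i < j → segment ℝ (P i i) (P i j) ⊆ R i j)
    (hr : ∀ i j, i < j → segment ℝ (P i j) (P j j) ⊆ R i j) :
    ∃ i j k l, i < j ∧ k < l ∧ i ≠ k ∧ i ≠ l ∧ j ≠ k ∧ j ≠ l ∧ (R i j ∩ R k l).Nonempty := by
  set a : Fin 5 × Fin 5 → ℝ := fun i => ((finProdFinEquiv i : ℕ) : ℝ)
  have ha : Function.Injective a := fun i j hij =>
    finProdFinEquiv.injective (Fin.ext (Nat.cast_injective hij))
  set v : Fin 5 → Fin 5 → EuclideanSpace ℝ (Fin 2) := fun i j => !₂[a (i, j), a (i, j) ^ 2]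
  have h1 := eventually_generalPosition (fun i : Fin 5 × Fin 5 => P i.1 i.2) ha
  have h2 : ∀ᶠ t : ℝ in 𝓝[>] 0, ∀ i j, i < j →
      segment ℝ (P i i + t • v i i) (P i j + t • v i j) ⊆ R i j := by
    simp only [eventually_all]
    exact fun i j hij => eventually_segment_subset (hR i j) (hl i j hij) _ _
  have h3 : ∀ᶠ t : ℝ in 𝓝[>] 0, ∀ i j, i < j →
      segment ℝ (P i j + t • v i j) (P j j + t • v j j) ⊆ R i j := by
    simp only [eventually_all]
    exact fun i j hij => eventually_segment_subset (hR i j) (hr i j hij) _ _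
  obtain ⟨t, ht1, ht2, ht3⟩ := (h1.and (h2.and h3)).exists
  exact GeneralPosition.exists_inter_nonempty (P := fun i j => P i j + t • v i j) ht1 ht2 ht3

section

variable {E : Type*} [NormedAddCommGroup E] [NormedSpace ℝ E] {A B : Set E} {φ : E →L[ℝ] ℝ} {c : ℝ}
  {x : E} {r : ℝ}

theorem TouchAlong.mem_interior (h : TouchAlong A B φ c x r) {y : E} (hy : y ∈ Metric.ball x r)
    (hc : c < φ y) : y ∈ interior A := by
  have hopen : IsOpen (Metric.ball x r ∩ {y | c < φ y}) :=
    Metric.isOpen_ball.inter (isOpen_lt continuous_const φ.continuous)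
  exact interior_maximal (fun z hz => h.left z hz.1 hz.2) hopen ⟨hy, hc⟩

theorem TouchAlong.nonempty_interior (h : TouchAlong A B φ c x r) : (interior A).Nonempty := by
  have hb : ∀ᶠ z in 𝓝 x, z ∈ Metric.ball x r := Metric.ball_mem_nhds x h.pos
  obtain ⟨z, hz, hzb⟩ := ((frequently_lt_apply h.ne_zero h.apply_eq).and_eventually hb).exists
  exact ⟨z, h.mem_interior hzb hz⟩

theorem TouchAlong.disjoint_interior (h : TouchAlong A B φ c x r) :
    Disjoint (interior A) (interior B) := by
  rw [Set.disjoint_left]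
  intro z hA hB
  have hz : φ z = c := le_antisymm (h.ge z (interior_subset hB)) (h.le z (interior_subset hA))
  have hb : ∀ᶠ w in 𝓝 z, w ∈ interior B := isOpen_interior.mem_nhds hB
  obtain ⟨w, hw, hwB⟩ := ((frequently_lt_apply h.ne_zero hz).and_eventually hb).exists
  exact absurd (h.ge w (interior_subset hwB)) (not_le.2 hw)

/-- The ball adds only limit points of the two interiors, so when two such regions meet, interiors
meet too. -/
theorem TouchAlong.subset_closure_interior (h : TouchAlong A B φ c x r) :
    interior A ∪ interior B ∪ Metric.ball x r ⊆ closure (interior A ∪ interior B) := by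
  refine union_subset subset_closure fun y hy => ?_
  rcases lt_trichotomy (φ y) c with hc | hc | hc
  · refine subset_closure (Or.inr (h.symm.mem_interior hy ?_))
    simpa using hc
  · rw [mem_closure_iff_frequently]
    have hb : ∀ᶠ z in 𝓝 y, z ∈ Metric.ball x r := Metric.isOpen_ball.mem_nhds hy
    exact ((frequently_lt_apply h.ne_zero hc).and_eventually hb).mono
      fun z hz => Or.inl (h.mem_interior hz.2 hz.1)
  · exact subset_closure (Or.inl (h.mem_interior hy hc))

theorem TouchAlong.segment_subset (h : TouchAlong A B φ c x r) (hA : Convex ℝ A) {a : E}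
    (ha : a ∈ interior A) : segment ℝ a x ⊆ interior A ∪ interior B ∪ Metric.ball x r := by
  have hx : x ∈ closure A :=
    h.inter_ball_subset_closure ⟨h.apply_eq, Metric.mem_ball_self h.pos⟩
  rw [← insert_endpoints_openSegment]
  rintro y (rfl | rfl | hy)
  · exact Or.inl (Or.inl ha)
  · exact Or.inr (Metric.mem_ball_self h.pos)
  · exact Or.inl (Or.inl (hA.openSegment_interior_closure_subset_interior ha hx hy))

end

/-- Among five convex sets in the plane, two do not touch. -/
theorem touchGraph_cliqueFree_five {ι : Type*} {K : ι → Set (EuclideanSpace ℝ (Fin 2))}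
    (hK : ∀ i, Convex ℝ (K i)) : (touchGraph K).CliqueFree 5 := by
  by_contra hnot
  rw [SimpleGraph.not_cliqueFree_iff_top_isContained] at hnot
  obtain ⟨f⟩ := hnot
  have hadj : ∀ i j : Fin 5, i ≠ j → ∃ φ c x r, TouchAlong (K (f i)) (K (f j)) φ c x r := by
    intro i j hij
    obtain ⟨-, H, φ, c, x, r, -, h⟩ :=
      f.toHom.map_adj (show (⊤ : SimpleGraph (Fin 5)).Adj i j from hij)
    exact ⟨φ, c, x, r, h⟩
  choose! φ c x r hT using hadj
  have hint : ∀ i, (interior (K (f i))).Nonempty := by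
    intro i
    obtain ⟨j, hj⟩ := exists_ne i
    exact (hT i j hj.symm).nonempty_interior
  choose a ha using hint
  -- Vertices are drawn at interior points `a i`, and the edge `ij` bends at the contact point `x i
  -- j` and stays inside `R i j`.
  set R : Fin 5 → Fin 5 → Set (EuclideanSpace ℝ (Fin 2)) := fun i j =>
    interior (K (f i)) ∪ interior (K (f j)) ∪ Metric.ball (x i j) (r i j) with hRdef
  have hR : ∀ i j, IsOpen (R i j) := fun i j =>
    (isOpen_interior.union isOpen_interior).union Metric.isOpen_ball
  obtain ⟨i, j, k, l, hij, hkl, hik, hil, hjk, hjl, z, hz, hz'⟩ :=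
    exists_inter_nonempty_of_segment_subset
      (P := fun i j => if i = j then a i else x i j) hR
      (fun i j hij => by
        simp only [if_true, hij.ne, if_false]
        exact (hT i j hij.ne).segment_subset (hK _) (ha i))
      (fun i j hij => by
        simp only [if_true, hij.ne, if_false]
        rw [segment_symm, hRdef]
        simp only
        rw [union_comm (interior (K (f i)))]
        exact (hT i j hij.ne).symm.segment_subset (hK _) (ha j))
  -- A common point of two regions is moved first into the interiors of one pair, then of the other,
  -- where disjointness for touching sets is violated.
  have hcl := (hT i j hij.ne).subset_closure_interior hz
  obtain ⟨w, hw, hw'⟩ := mem_closure_iff.1 hcl _ (hR k l) hz'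
  have hcl' := (hT k l hkl.ne).subset_closure_interior hw
  obtain ⟨u, hu, hu'⟩ := mem_closure_iff.1 hcl' _ (isOpen_interior.union isOpen_interior) hw'
  rcases hu with hu | hu <;> rcases hu' with hu' | hu'
  · exact disjoint_left.1 (hT i k hik).disjoint_interior hu hu'
  · exact disjoint_left.1 (hT i l hil).disjoint_interior hu hu'
  · exact disjoint_left.1 (hT j k hjk).disjoint_interior hu hu'
  · exact disjoint_left.1 (hT j l hjl).disjoint_interior hu hu'

end Drawings

/-! ### Wall systems: cells of a multipartite graph with many ordinary hyperplanes. -/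

section Walls

variable {E : Type*} [NormedAddCommGroup E] [NormedSpace ℝ E] {ι : Type*}

/-- The open cell of a vertex `i`: the intersection of the open half-spaces `{c i j < φ i j}`
over the neighbours `j` of `i`. -/
def openCell (G : SimpleGraph ι) (φ : ι → ι → E →L[ℝ] ℝ) (c : ι → ι → ℝ) (i : ι) : Set E :=
  {x | ∀ j, G.Adj i j → c i j < φ i j x}

theorem convex_openCell (G : SimpleGraph ι) (φ : ι → ι → E →L[ℝ] ℝ) (c : ι → ι → ℝ) (i : ι) :
    Convex ℝ (openCell G φ c i) := by
  have : openCell G φ c i = ⋂ j, ⋂ _ : G.Adj i j, {x | c i j < φ i j x} := by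
    ext x; simp [openCell]
  rw [this]
  exact convex_iInter fun j => convex_iInter fun _ =>
    convex_halfSpace_gt (φ i j).isBoundedLinearMap.toIsLinearMap _

/-- The complement of finitely many open cells has a strong cover. -/
theorem exists_isStrongCover_compl_openCell [FiniteDimensional ℝ E] [Finite ι]
    (G : SimpleGraph ι) (φ : ι → ι → E →L[ℝ] ℝ) (c : ι → ι → ℝ) :
    ∃ C, IsStrongCover (⋃ i, openCell G φ c i)ᶜ C := by
  -- A point outside all cells violates some inequality of each; a choice `f` of violated ones cuts
  -- out a closed convex set.
  have hS : (⋃ i, openCell G φ c i)ᶜ = ⋃ f : {f : ι → ι // ∀ i, G.Adj i (f i)},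
      ⋂ i, {x | φ i (f.1 i) x ≤ c i (f.1 i)} := by
    ext x
    simp only [openCell, mem_compl_iff, mem_iUnion, mem_ofPred_eq, not_exists, not_forall, not_lt,
      mem_iInter, Subtype.exists, exists_prop]
    rw [Classical.skolem]
    simp only [forall_and]
  rw [hS]
  refine exists_isStrongCover_iUnion (fun f => ?_) (fun f => ?_)
  · exact isClosed_iInter fun i => isClosed_le (φ _ _).continuous continuous_const
  · exact convex_iInter fun i => convex_halfSpace_le (φ _ _).isBoundedLinearMap.toIsLinearMap _

/-- Half-spaces attached to the edges of a complete multipartite graph such that the cells of any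
two adjacent vertices share a piece of the hyperplane between them, and such that these hyperplanes
are distinct. -/
structure IsWallSystem (G : SimpleGraph ι) (φ : ι → ι → E →L[ℝ] ℝ) (c : ι → ι → ℝ) : Prop where
  adj_or_adj : ∀ i j k, G.Adj i j → G.Adj k i ∨ G.Adj k j
  map_swap : ∀ i j, G.Adj i j → φ j i = -φ i j
  const_swap : ∀ i j, G.Adj i j → c j i = -c i j
  ne_zero : ∀ i j, G.Adj i j → φ i j ≠ 0
  exists_wall : ∀ i j, G.Adj i j → ∃ p, φ i j p = c i j ∧
    (∀ k, G.Adj i k → k ≠ j → c i k < φ i k p) ∧ (∀ k, G.Adj j k → k ≠ i → c j k < φ j k p)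
  injective : ∀ i j k l, G.Adj i j → G.Adj k l →
    hyperplane (φ i j) (c i j) = hyperplane (φ k l) (c k l) → s(i, j) = s(k, l)

namespace IsWallSystem

variable [FiniteDimensional ℝ E] [Finite ι] {G : SimpleGraph ι} {φ : ι → ι → E →L[ℝ] ℝ}
  {c : ι → ι → ℝ}

/-- Near the wall point, all constraints of cells `i` and `j` but their mutual one hold, so these
cells fill the two sides. A third cell is adjacent to one of them and kept away by the wall between
them. -/
theorem isOrdinaryFlat (h : IsWallSystem G φ c) {i j : ι} (hij : G.Adj i j) :
    IsOrdinaryFlat (Module.finrank ℝ E - 1) (⋃ i, openCell G φ c i)ᶜ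
      (hyperplane (φ i j) (c i j)) := by
  obtain ⟨p, hp, hpi, hpj⟩ := h.exists_wall i j hij
  set V : ι → ι → Set E := fun i j => {x | ∀ k, G.Adj i k → k ≠ j → c i k < φ i k x}
  have hV : ∀ i j, IsOpen (V i j) := by
    intro i j
    have : V i j = ⋂ k, ⋂ _ : G.Adj i k, ⋂ _ : k ≠ j, {x | c i k < φ i k x} := by
      ext x; simp [V]
    rw [this]
    exact isOpen_iInter_of_finite fun k => isOpen_iInter_of_finite fun _ =>
      isOpen_iInter_of_finite fun _ => isOpen_lt continuous_const (φ i k).continuous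
  have hU : IsOpen (V i j ∩ V j i) := (hV i j).inter (hV j i)
  have hSU : (⋃ i, openCell G φ c i)ᶜ ∩ (V i j ∩ V j i) =
      (hyperplane (φ i j) (c i j) : Set E) ∩ (V i j ∩ V j i) := by
    ext x
    simp only [mem_inter_iff, mem_compl_iff, mem_iUnion, not_exists, SetLike.mem_coe,
      mem_hyperplane, and_congr_left_iff]
    rintro ⟨hxi, hxj⟩
    constructor
    · intro hx
      by_contra hne
      rcases lt_or_gt_of_ne hne with hlt | hgt
      · refine hx j fun k hk => ?_
        by_cases hki : k = i
        · subst hki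
          rw [h.map_swap _ _ hij, h.const_swap _ _ hij]
          simpa using hlt
        · exact hxj k hk hki
      · refine hx i fun k hk => ?_
        by_cases hkj : k = j
        · subst hkj; exact hgt
        · exact hxi k hk hkj
    · intro hx k hk
      have hk : ∀ l, G.Adj k l → c k l < φ k l x := hk
      by_cases hki : k = i
      · subst hki
        exact absurd hx (hk j hij).ne'
      by_cases hkj : k = j
      · subst hkj
        have := hk i hij.symm
        rw [h.map_swap _ _ hij, h.const_swap _ _ hij, neg_apply, neg_lt_neg_iff] at this
        exact absurd hx this.ne
      rcases h.adj_or_adj i j k hij with hadj | hadj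
      · have h1 := hk i hadj
        rw [h.map_swap _ _ hadj.symm, h.const_swap _ _ hadj.symm, neg_apply, neg_lt_neg_iff] at h1
        exact absurd h1 (hxi k hadj.symm hkj).not_gt
      · have h1 := hk j hadj
        rw [h.map_swap _ _ hadj.symm, h.const_swap _ _ hadj.symm, neg_apply, neg_lt_neg_iff] at h1
        exact absurd h1 (hxj k hadj.symm hki).not_gt
  have hflat := isFlat_hyperplane (h.ne_zero i j hij) (c i j)
  exact ⟨hflat, p, (hSU.superset ⟨hp, hpi, hpj⟩).1, hflat.localDim_eq hU hSU hp ⟨hpi, hpj⟩, _, hU,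
    ⟨hpi, hpj⟩, hSU⟩

theorem encard_edgeSet_le (h : IsWallSystem G φ c) :
    G.edgeSet.encard ≤
      {H | IsOrdinaryFlat (Module.finrank ℝ E - 1) (⋃ i, openCell G φ c i)ᶜ H}.encard := by
  have key : ∀ e : G.edgeSet, ∃ i j, G.Adj i j ∧ e.1 = s(i, j) := by
    rintro ⟨e, he⟩
    induction e with
    | _ i j => exact ⟨i, j, he, rfl⟩
  choose i j hadj he using key
  let f : G.edgeSet ↪
      {H | IsOrdinaryFlat (Module.finrank ℝ E - 1) (⋃ i, openCell G φ c i)ᶜ H} :=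
    ⟨fun e => ⟨hyperplane (φ (i e) (j e)) (c (i e) (j e)), h.isOrdinaryFlat (hadj e)⟩, by
      intro e e' hee'
      apply Subtype.ext
      rw [he, he]
      exact h.injective _ _ _ _ (hadj e) (hadj e') (Subtype.ext_iff.1 hee')⟩
  exact f.encard_le

end IsWallSystem

end Walls

/-- If the touching graphs of all families of `n` convex sets in `ℝ^d` have at most `N` edges,
and some wall system has `N` edges, then `N` is the maximum of both counts. -/
theorem isGreatest_counts {d n N : ℕ} (hd : 0 < d)
    (hupper : ∀ K : Fin n → Set (EuclideanSpace ℝ (Fin d)), (∀ i, Convex ℝ (K i)) →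
      (touchGraph K).edgeSet.encard ≤ N)
    {G : SimpleGraph (Fin n)} {φ : Fin n → Fin n → EuclideanSpace ℝ (Fin d) →L[ℝ] ℝ}
    {c : Fin n → Fin n → ℝ} (hwall : IsWallSystem G φ c) (hG : N ≤ G.edgeSet.encard) :
    IsGreatest (strongCoverCounts (d - 1) d n) (N : ℕ∞) ∧
      IsGreatest (ordinaryFlatCounts (d - 1) d n) (N : ℕ∞) := by
  have hk : d - 1 + 1 = Module.finrank ℝ (EuclideanSpace ℝ (Fin d)) := by
    rw [finrank_euclideanSpace_fin]; omega
  have hub : ∀ K : Fin n → Set (EuclideanSpace ℝ (Fin d)), (∀ i, Convex ℝ (K i)) →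
      {H | IsOrdinaryFlat (d - 1) (⋃ i, K i)ᶜ H}.encard ≤ N := fun K hK =>
    (encard_isOrdinaryFlat_le hK hk).trans (hupper K hK)
  have heq : (N : ℕ∞) = {H | IsOrdinaryFlat (d - 1) (⋃ i, openCell G φ c i)ᶜ H}.encard := by
    refine le_antisymm ?_ (hub _ (convex_openCell G φ c))
    have := hG.trans hwall.encard_edgeSet_le
    rwa [finrank_euclideanSpace_fin] at this
  refine ⟨⟨?_, ?_⟩, ⟨?_, ?_⟩⟩
  · obtain ⟨C, hC⟩ := exists_isStrongCover_compl_openCell G φ c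
    exact ⟨_, convex_openCell G φ c, C, hC, by rw [hC.setOf_isFlat_eq, heq]⟩
  · rintro _ ⟨K, hK, C, hC, rfl⟩
    rw [hC.setOf_isFlat_eq]
    exact hub K hK
  · exact ⟨_, convex_openCell G φ c, heq⟩
  · rintro _ ⟨K, hK, rfl⟩
    exact hub K hK

/-! ### Construction for `d ≥ 3`, using three coordinates only. -/

section MomentCurve

/-- The hyperplanes between the cells of the upper envelope of the affine functions
`x₀ t + x₁ t² + x₂ t³ - t⁴`, for `t = 0, …, n - 1`. -/
theorem exists_isWallSystem_top {d : ℕ} (hd : 3 ≤ d) (n : ℕ) :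
    ∃ (φ : Fin n → Fin n → EuclideanSpace ℝ (Fin d) →L[ℝ] ℝ) (c : Fin n → Fin n → ℝ),
      IsWallSystem (⊤ : SimpleGraph (Fin n)) φ c := by
  let e : Fin 3 → Fin d := Fin.castLE hd
  have he : ∀ {i j}, e i = e j ↔ i = j := fun {i j} => (Fin.castLE_injective hd).eq_iff
  let F : Fin n → EuclideanSpace ℝ (Fin d) →L[ℝ] ℝ := fun i =>
    (i : ℝ) • EuclideanSpace.proj (e 0) + ((i : ℝ) ^ 2) • EuclideanSpace.proj (e 1) +
      ((i : ℝ) ^ 3) • EuclideanSpace.proj (e 2)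
  -- the point with prescribed first three coordinates
  let pt : ℝ → ℝ → ℝ → EuclideanSpace ℝ (Fin d) := fun x y z =>
    EuclideanSpace.single (e 0) x + EuclideanSpace.single (e 1) y + EuclideanSpace.single (e 2) z
  have hF : ∀ i x y z, F i (pt x y z) = i * x + (i : ℝ) ^ 2 * y + (i : ℝ) ^ 3 * z := by
    intro i x y z
    simp [F, pt, he]
  have hinj : ∀ {i j : Fin n}, i ≠ j → (i : ℝ) - j ≠ 0 := fun {i j} hij =>
    sub_ne_zero.2 fun h => hij (Fin.ext (Nat.cast_injective h))
  refine ⟨fun i j => F i - F j, fun i j => (i : ℝ) ^ 4 - (j : ℝ) ^ 4, ?_, ?_, ?_, ?_, ?_, ?_⟩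
  · intro i j k hij
    by_contra! h
    simp only [SimpleGraph.top_adj, ne_eq, not_not] at h hij
    exact hij (h.1.symm.trans h.2)
  · intro i j _
    simp
  · intro i j _
    ring
  · intro i j hij h0
    have : (F i - F j) (pt 1 0 0) = 0 := by rw [h0]; rfl
    rw [sub_apply, hF, hF] at this
    exact hinj hij (by linarith)
  · intro i j hij
    have hpos : ∀ k : Fin n, k ≠ i → k ≠ j → 0 < ((k : ℝ) - i) ^ 2 * ((k : ℝ) - j) ^ 2 :=
      fun k hki hkj => mul_pos (sq_pos_of_ne_zero (hinj hki)) (sq_pos_of_ne_zero (hinj hkj))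
    -- The coefficients of `(t - i)² (t - j)²`: at this point the function of parameter `t` has the
    -- value `i² j² - (t - i)² (t - j)²`, largest exactly at `t = i` and `t = j`.
    refine ⟨pt (2 * i * j * (i + j)) (-((i + j) ^ 2 + 2 * i * j)) (2 * (i + j)), ?_, ?_, ?_⟩
    · simp only [sub_apply, hF]
      ring
    · intro k hk hkj
      have := hpos k (SimpleGraph.Adj.ne hk).symm hkj
      simp only [sub_apply, hF]
      nlinarith
    · intro k hk hki
      have := hpos k hki (SimpleGraph.Adj.ne hk).symm
      simp only [sub_apply, hF]
      nlinarith
  · intro i j k l hij hkl h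
    have hij := hinj (SimpleGraph.Adj.ne hij)
    have hkl := hinj (SimpleGraph.Adj.ne hkl)
    -- The wall equation divided by `i - j`. Testing three points of the wall recovers `i + j` and
    -- `i² + i j + j²`, hence the pair.
    have hmem : ∀ x y z : ℝ,
        x + (i + j) * y + ((i : ℝ) ^ 2 + i * j + j ^ 2) * z = (i + j) * ((i : ℝ) ^ 2 + j ^ 2) →
        x + (k + l) * y + ((k : ℝ) ^ 2 + k * l + l ^ 2) * z = (k + l) * ((k : ℝ) ^ 2 + l ^ 2) := by
      intro x y z hxyz
      have h1 : pt x y z ∈ hyperplane (F i - F j) ((i : ℝ) ^ 4 - (j : ℝ) ^ 4) := by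
        rw [mem_hyperplane, sub_apply, hF, hF]
        linear_combination ((i : ℝ) - j) * hxyz
      rw [h, mem_hyperplane, sub_apply, hF, hF] at h1
      apply mul_left_cancel₀ hkl
      linear_combination h1
    have h0 := hmem ((i + j) * ((i : ℝ) ^ 2 + j ^ 2)) 0 0 (by ring)
    have h1 := hmem ((i + j) * ((i : ℝ) ^ 2 + j ^ 2) - (i + j)) 1 0 (by ring)
    have h2 := hmem ((i + j) * ((i : ℝ) ^ 2 + j ^ 2) - ((i : ℝ) ^ 2 + i * j + j ^ 2)) 0 1 (by ring)
    have hs : (k : ℝ) + l = i + j := by linarith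
    have hq : (k : ℝ) ^ 2 + k * l + l ^ 2 = (i : ℝ) ^ 2 + i * j + j ^ 2 := by linarith
    have hprod : ((k : ℝ) - i) * ((k : ℝ) - j) = 0 := by
      linear_combination hq - ((i : ℝ) + j + l) * hs
    have hcast : ∀ {a b : Fin n}, (a : ℝ) = b → a = b := fun h => Fin.ext (Nat.cast_injective h)
    rw [Sym2.eq_iff]
    rcases mul_eq_zero.1 hprod with h | h
    · exact Or.inl ⟨hcast (by linarith), hcast (by linarith)⟩
    · exact Or.inr ⟨hcast (by linarith), hcast (by linarith)⟩

end MomentCurve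

theorem isGreatest_counts_of_three_le {d : ℕ} (hd : 3 ≤ d) (n : ℕ) :
    IsGreatest (strongCoverCounts (d - 1) d n) (n.choose 2 : ℕ∞) ∧
      IsGreatest (ordinaryFlatCounts (d - 1) d n) (n.choose 2 : ℕ∞) := by
  classical
  obtain ⟨φ, c, h⟩ := exists_isWallSystem_top hd n
  refine isGreatest_counts (by omega) (fun K _ => ?_) h ?_
  · rw [← SimpleGraph.coe_edgeFinset, encard_coe_eq_coe_finsetCard]
    have := (touchGraph K).card_edgeFinset_le_card_choose_two
    rw [Fintype.card_fin] at this
    exact_mod_cast this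
  · rw [← SimpleGraph.coe_edgeFinset, encard_coe_eq_coe_finsetCard,
      SimpleGraph.card_edgeFinset_top_eq_card_choose_two, Fintype.card_fin]

/-! ### Construction in the plane for the Turán graph. -/

section PlanarWalls

/-- The index of the part of a vertex of the Turán graph with four parts. -/
def turanPart {n : ℕ} (v : Fin n) : Fin 4 := ⟨v % 4, Nat.mod_lt _ (by norm_num)⟩

/-- The coefficients of `x` in the four affine functions `0`, `x - 1`, `y - 1`, `-x - y - 1`, whose
upper envelope divides the plane into four regions any two of which share a side. -/
def envX : Fin 4 → ℤ := ![0, 1, 0, -1]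

/-- The coefficients of `y` in the four affine functions. -/
def envY : Fin 4 → ℤ := ![0, 0, 1, -1]

/-- The constant terms of the four affine functions. -/
def envC : Fin 4 → ℤ := ![0, -1, -1, -1]

/-- The first coordinate of a point on the common side of two of the regions. -/
def sideX : Fin 4 → Fin 4 → ℤ := ![![0, 1, 0, 0], ![0, 0, 2, 2], ![0, 0, 0, -4], ![0, 0, 0, 0]]

/-- The second coordinate of a point on the common side of two of the regions. -/
def sideY : Fin 4 → Fin 4 → ℤ := ![![0, 0, 1, -1], ![0, 0, 2, -4], ![0, 0, 0, 2], ![0, 0, 0, 0]]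

/-- The difference of the affine functions `C` and `D` at the chosen point of the side between
the regions `A` and `B`. -/
def sideGap (A B C D : Fin 4) : ℤ :=
  (envX C - envX D) * sideX A B + (envY C - envY D) * sideY A B + (envC C - envC D)

/-- Only the table entries with `A < B` describe sides; the others are placeholders. -/
theorem sideGap_self : ∀ {A B : Fin 4}, A < B → sideGap A B A B = 0 := by decide

theorem sideGap_pos : ∀ {A B C : Fin 4}, A < B → C ≠ A → C ≠ B →
    0 < sideGap A B A C ∧ 0 < sideGap A B B C := by decide

/-- The side points also avoid ties between the two functions not involved, so the walls of every
other side have a definite sign there. -/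
theorem sideGap_ne_zero : ∀ {A B C D : Fin 4}, A < B → C < D → (A, B) ≠ (C, D) →
    sideGap A B C D ≠ 0 := by decide

theorem sideGap_swap (A B C D : Fin 4) : sideGap A B D C = -sideGap A B C D := by
  simp only [sideGap]; ring

/-- The squared length of the gradient of the difference of two of the affine functions. -/
def envNormSq (A B : Fin 4) : ℤ := (envX A - envX B) ^ 2 + (envY A - envY B) ^ 2

theorem envNormSq_ne_zero : ∀ {A B : Fin 4}, A < B → envNormSq A B ≠ 0 := by decide

/-- The height over the side between two regions of the wall between two cells. For fixed `T`, the
walls for the various `s` bound a convex polygon from below, and for fixed `s`, the walls for the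
various `T` bound one from above. -/
noncomputable def wallHeight (T s u : ℝ) : ℝ := (s - T) * u - s * T - (s ^ 2 - T ^ 2) / 2

/-- The coordinate along the side between the regions `A` and `B`. -/
noncomputable def sideCoord (A B : Fin 4) (x y : ℝ) : ℝ :=
  (-(envY A - envY B) * (x - sideX A B) + (envX A - envX B) * (y - sideY A B)) / envNormSq A B

/-- The affine function whose zero set is the wall with parameters `T` and `s` between the regions
`A` and `B`. -/
noncomputable def wallFun (A B : Fin 4) (T s x y : ℝ) : ℝ :=
  (envX A - envX B) * x + (envY A - envY B) * y + (envC A - envC B) -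
    wallHeight T s (sideCoord A B x y)

/-- The first coordinate of the point at position `u` along the side between `A` and `B`, and
at height `h` over it. -/
noncomputable def pointX (A B : Fin 4) (u h : ℝ) : ℝ :=
  sideX A B - (envY A - envY B) * u + (envX A - envX B) * h / envNormSq A B

/-- The second coordinate of the point at position `u` along the side between `A` and `B`, and
at height `h` over it. -/
noncomputable def pointY (A B : Fin 4) (u h : ℝ) : ℝ :=
  sideY A B + (envX A - envX B) * u + (envY A - envY B) * h / envNormSq A B

/-- In the coordinates `u` along the side and `h`, the value of the difference of the two affine
functions, the wall is the graph of `wallHeight T s`. -/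
theorem wallFun_point {A B : Fin 4} (hAB : A < B) (T s u h : ℝ) :
    wallFun A B T s (pointX A B u h) (pointY A B u h) = h - wallHeight T s u := by
  have hN : (envNormSq A B : ℝ) ≠ 0 := by exact_mod_cast envNormSq_ne_zero hAB
  have hN' : (envNormSq A B : ℝ) = ((envX A : ℝ) - envX B) ^ 2 + ((envY A : ℝ) - envY B) ^ 2 := by
    simp only [envNormSq]; push_cast; ring
  have hgap : ((envX A : ℝ) - envX B) * sideX A B + (envY A - envY B) * sideY A B +
      (envC A - envC B) = 0 := by
    have := sideGap_self hAB
    simp only [sideGap] at this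
    exact_mod_cast this
  have hcoord : sideCoord A B (pointX A B u h) (pointY A B u h) = u := by
    simp only [sideCoord, pointX, pointY]
    field_simp
    rw [hN']
    ring
  rw [wallFun, hcoord]
  congr 1
  simp only [pointX, pointY]
  field_simp
  linear_combination -h * hN' + (envNormSq A B : ℝ) * hgap

/-- A wall is an affine line. -/
theorem wallFun_eq (A B : Fin 4) (T s x y : ℝ) :
    wallFun A B T s x y = (wallFun A B T s 1 0 - wallFun A B T s 0 0) * x +
      (wallFun A B T s 0 1 - wallFun A B T s 0 0) * y + wallFun A B T s 0 0 := by
  simp only [wallFun, wallHeight, sideCoord]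
  ring

/-- Near the side between `A` and `B`, a wall of another side does not change sign. -/
theorem eventually_wallFun_mul_pos {A B C D : Fin 4} (hAB : A < B) (hCD : C < D)
    (hne : (A, B) ≠ (C, D)) (T s T' s' : ℝ) :
    ∀ᶠ δ : ℝ in 𝓝[>] 0,
      0 < wallFun C D (δ * T') (δ * s')
        (pointX A B (δ * T + δ * s) (wallHeight (δ * T) (δ * s) (δ * T + δ * s)))
        (pointY A B (δ * T + δ * s) (wallHeight (δ * T) (δ * s) (δ * T + δ * s))) *
        sideGap A B C D := by
  have hc : Continuous fun δ : ℝ => wallFun C D (δ * T') (δ * s')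
        (pointX A B (δ * T + δ * s) (wallHeight (δ * T) (δ * s) (δ * T + δ * s)))
        (pointY A B (δ * T + δ * s) (wallHeight (δ * T) (δ * s) (δ * T + δ * s))) *
        (sideGap A B C D : ℝ) := by
    unfold wallFun wallHeight sideCoord pointX pointY
    fun_prop
  have h0 := hc.tendsto 0
  refine (h0.mono_left nhdsWithin_le_nhds).eventually (lt_mem_nhds ?_)
  have hgap : (sideGap A B C D : ℝ) ≠ 0 := by exact_mod_cast sideGap_ne_zero hAB hCD hne
  -- As `δ` tends to `0` the walls shrink back to the unperturbed sides and the contact point to the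
  -- side point, so the product tends to the square of the gap.
  have : wallFun C D 0 0 (sideX A B) (sideY A B) = sideGap A B C D := by
    simp [wallFun, wallHeight, sideGap]
  have hpos := mul_self_pos.2 hgap
  simpa [pointX, pointY, wallHeight, this] using hpos

variable {n : ℕ}

/-- The signed wall function of two vertices in different parts. -/
noncomputable def cellFun (T s : Fin n → ℝ) (v w : Fin n) (x y : ℝ) : ℝ :=
  if turanPart v < turanPart w then wallFun (turanPart v) (turanPart w) (T v) (s w) x y
  else -wallFun (turanPart w) (turanPart v) (T w) (s v) x y

theorem cellFun_swap (T s : Fin n → ℝ) {v w : Fin n} (h : turanPart v ≠ turanPart w) (x y : ℝ) :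
    cellFun T s w v x y = -cellFun T s v w x y := by
  rcases h.lt_or_gt with h | h <;> simp [cellFun, h, h.not_gt]

theorem cellFun_eq (T s : Fin n → ℝ) (v w : Fin n) (x y : ℝ) :
    cellFun T s v w x y = (cellFun T s v w 1 0 - cellFun T s v w 0 0) * x +
      (cellFun T s v w 0 1 - cellFun T s v w 0 0) * y + cellFun T s v w 0 0 := by
  unfold cellFun
  split_ifs
  · exact wallFun_eq ..
  · rw [wallFun_eq]; ring

/-- The first coordinate of the point where two cells touch. -/
noncomputable def contactX (T s : Fin n → ℝ) (v w : Fin n) : ℝ :=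
  pointX (turanPart v) (turanPart w) (T v + s w) (wallHeight (T v) (s w) (T v + s w))

/-- The second coordinate of the point where two cells touch. -/
noncomputable def contactY (T s : Fin n → ℝ) (v w : Fin n) : ℝ :=
  pointY (turanPart v) (turanPart w) (T v + s w) (wallHeight (T v) (s w) (T v + s w))

/-- Admissible parameters of the walls: the steps of `T` are large in comparison with `s`, and near
each side of the four regions no walls of other sides interfere. -/
structure IsAdmissible (T s : Fin n → ℝ) : Prop where
  injective : Function.Injective s
  nonneg : ∀ v, 0 ≤ s v
  lt_abs : ∀ u v w, v ≠ w → 8 * s u < |T v - T w|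
  far : ∀ v w k l, turanPart v < turanPart w → turanPart k < turanPart l →
    (turanPart v, turanPart w) ≠ (turanPart k, turanPart l) →
    0 < wallFun (turanPart k) (turanPart l) (T k) (s l) (contactX T s v w) (contactY T s v w) *
      sideGap (turanPart v) (turanPart w) (turanPart k) (turanPart l)

/-- Integer steps for `T` and values below `1 / 8` for `s` give the inequalities, which survive
scaling by `δ`; a small `δ` gives `far`. -/
theorem exists_isAdmissible (n : ℕ) : ∃ T s : Fin n → ℝ, IsAdmissible T s := by
  set T : Fin n → ℝ := fun v => v
  set s : Fin n → ℝ := fun v => (v : ℝ) / (8 * n)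
  have hfar : ∀ᶠ δ : ℝ in 𝓝[>] 0, ∀ v w k l, turanPart v < turanPart w →
      turanPart k < turanPart l → (turanPart v, turanPart w) ≠ (turanPart k, turanPart l) →
      0 < wallFun (turanPart k) (turanPart l) (δ * T k) (δ * s l)
        (contactX (fun v => δ * T v) (fun v => δ * s v) v w)
        (contactY (fun v => δ * T v) (fun v => δ * s v) v w) *
      sideGap (turanPart v) (turanPart w) (turanPart k) (turanPart l) := by
    simp only [eventually_all]
    intro v w k l h1 h2 h3
    exact eventually_wallFun_mul_pos h1 h2 h3 _ _ _ _
  obtain ⟨δ, hδ, hδ0⟩ := (hfar.and self_mem_nhdsWithin).exists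
  have hδ0 : 0 < δ := hδ0
  refine ⟨fun v => δ * T v, fun v => δ * s v, ?_, ?_, ?_, hδ⟩
  · intro v w hvw
    have hn : (0 : ℝ) < n := by exact_mod_cast v.pos
    have h1 := mul_left_cancel₀ hδ0.ne' hvw
    simp only [s] at h1
    rw [div_left_inj' (by positivity)] at h1
    exact Fin.ext (Nat.cast_injective h1)
  · intro v
    positivity
  · intro u v w hvw
    have hn : (0 : ℝ) < n := by exact_mod_cast u.pos
    have hu : (u : ℝ) < n := by exact_mod_cast u.isLt
    have h1 : 8 * s u < 1 := by
      simp only [s]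
      rw [mul_div_assoc', div_lt_one (by positivity)]
      linarith
    have h2 : 1 ≤ |T v - T w| := by
      have : ((v : ℕ) : ℤ) ≠ (w : ℕ) := fun h => hvw (Fin.ext (by exact_mod_cast h))
      have := Int.one_le_abs (sub_ne_zero.2 this)
      simp only [T]
      exact_mod_cast this
    rw [← mul_sub, abs_mul, abs_of_pos hδ0]
    nlinarith

namespace IsAdmissible

variable {T s : Fin n → ℝ}

theorem wallFun_contact (v w : Fin n) (h : turanPart v < turanPart w) (T' s' : ℝ) :
    wallFun (turanPart v) (turanPart w) T' s' (contactX T s v w) (contactY T s v w) =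
      wallHeight (T v) (s w) (T v + s w) - wallHeight T' s' (T v + s w) :=
  wallFun_point h _ _ _ _

/-- At `u = T v + s w` the height is maximal over `s` exactly at `s w`, by a margin of half the
squared difference. -/
theorem wallFun_pos (hA : IsAdmissible T s) {v w w' : Fin n} (h : turanPart v < turanPart w)
    (hne : w' ≠ w) :
    0 < wallFun (turanPart v) (turanPart w) (T v) (s w') (contactX T s v w)
      (contactY T s v w) := by
  rw [wallFun_contact v w h]
  have : 0 < (s w - s w') ^ 2 := sq_pos_of_ne_zero (sub_ne_zero.2 (hA.injective.ne hne.symm))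
  simp only [wallHeight]
  nlinarith

/-- Over all real `T` the height at `u = T v + s w` is minimal at `T v + 2 * s w`, slightly off `T
v`; the gaps in `T` are so large that `T v` is still the best of the given values. -/
theorem wallFun_neg (hA : IsAdmissible T s) {v w k : Fin n} (h : turanPart v < turanPart w)
    (hne : k ≠ v) :
    wallFun (turanPart v) (turanPart w) (T k) (s w) (contactX T s v w)
      (contactY T s v w) < 0 := by
  rw [wallFun_contact v w h]
  have h1 := hA.lt_abs w v k hne.symm
  have h2 := hA.nonneg w
  have h3 : wallHeight (T v) (s w) (T v + s w) - wallHeight (T k) (s w) (T v + s w) =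
      -((T v - T k) * (2 * s w) + (T v - T k) ^ 2 / 2) := by
    simp only [wallHeight]; ring
  rw [h3, ← sq_abs]
  have h4 := neg_abs_le (T v - T k)
  nlinarith [abs_nonneg (T v - T k)]

/-- The two cells at a contact point are not cut off there by third cells. -/
theorem cellFun_pos (hA : IsAdmissible T s) {v w : Fin n} (h : turanPart v < turanPart w) :
    (∀ k, turanPart v ≠ turanPart k → k ≠ w →
      0 < cellFun T s v k (contactX T s v w) (contactY T s v w)) ∧
    (∀ k, turanPart w ≠ turanPart k → k ≠ v →
      0 < cellFun T s w k (contactX T s v w) (contactY T s v w)) := by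
  have hpos : ∀ {a b : Fin 4}, 0 < sideGap (turanPart v) (turanPart w) a b →
      (0 : ℝ) < sideGap (turanPart v) (turanPart w) a b := fun h => by exact_mod_cast h
  have hneg : ∀ {a b : Fin 4}, 0 < sideGap (turanPart v) (turanPart w) a b →
      (sideGap (turanPart v) (turanPart w) b a : ℝ) < 0 := fun h => by
    rw [sideGap_swap]; push_cast; linarith [hpos h]
  constructor
  · intro k hk hkw
    rcases hk.lt_or_gt with hlt | hgt
    · simp only [cellFun, hlt, if_true]
      -- A wall towards the part of `w` belongs to the same side and is compared by heights; any
      -- other wall has the sign of the unperturbed gap.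
      by_cases hpart : turanPart k = turanPart w
      · rw [hpart]
        exact hA.wallFun_pos h hkw
      · have h1 := hA.far v w v k h hlt (by simp [Ne.symm hpart])
        exact pos_of_mul_pos_left h1 (hpos (sideGap_pos h hk.symm hpart).1).le
    · simp only [cellFun, hgt.not_gt, if_false]
      have h1 := hA.far v w k v h hgt (by simp [hk])
      have hkw' : turanPart k ≠ turanPart w := (hgt.trans h).ne
      have h2 := hneg (sideGap_pos h hk.symm hkw').1
      exact neg_pos.2 (neg_of_mul_pos_left h1 h2.le)
  · intro k hk hkv
    rcases hk.lt_or_gt with hlt | hgt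
    · simp only [cellFun, hlt, if_true]
      have h1 := hA.far v w w k h hlt (by simp [h.ne])
      have hkv' : turanPart k ≠ turanPart v := (h.trans hlt).ne'
      exact pos_of_mul_pos_left h1 (hpos (sideGap_pos h hkv' hk.symm).2).le
    · simp only [cellFun, hgt.not_gt, if_false]
      by_cases hpart : turanPart k = turanPart v
      · rw [hpart]
        exact neg_pos.2 (hA.wallFun_neg h hkv)
      · have h1 := hA.far v w k w h hgt (by simp [Ne.symm hpart])
        have h2 := hneg (sideGap_pos h hpart hk.symm).2
        exact neg_pos.2 (neg_of_mul_pos_left h1 h2.le)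

/-- Different walls lie on different lines. -/
theorem eq_of_forall_wallFun (hA : IsAdmissible T s) {v w k l : Fin n}
    (h : turanPart v < turanPart w) (h' : turanPart k < turanPart l)
    (heq : ∀ x y, wallFun (turanPart v) (turanPart w) (T v) (s w) x y = 0 →
      wallFun (turanPart k) (turanPart l) (T k) (s l) x y = 0) : v = k ∧ w = l := by
  by_cases hpart : (turanPart v, turanPart w) = (turanPart k, turanPart l)
  · rw [Prod.mk.injEq] at hpart
    rw [← hpart.1, ← hpart.2] at heq
    have hH : ∀ u, wallHeight (T v) (s w) u = wallHeight (T k) (s l) u := by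
      intro u
      have := heq (pointX (turanPart v) (turanPart w) u (wallHeight (T v) (s w) u))
        (pointY (turanPart v) (turanPart w) u (wallHeight (T v) (s w) u))
        (by rw [wallFun_point h, sub_self])
      rwa [wallFun_point h, sub_eq_zero] at this
    have h0 := hH 0
    have h1 := hH 1
    simp only [wallHeight] at h0 h1
    -- Equal slopes force `T v - T k = s w - s l`, which is too small unless `v = k`.
    have hslope : s w - T v = s l - T k := by linarith
    have hvk : v = k := by
      by_contra hne
      have e1 := hA.lt_abs w v k hne
      have e2 := hA.lt_abs l v k hne
      have e3 := hA.nonneg w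
      have e4 := hA.nonneg l
      have : T v - T k = s w - s l := by linarith
      rw [this] at e1 e2
      rcases abs_cases (s w - s l) with ⟨h, -⟩ | ⟨h, -⟩ <;> rw [h] at e1 e2 <;> linarith
    subst hvk
    exact ⟨rfl, hA.injective (by linarith)⟩
  · have h1 := hA.far v w k l h h' hpart
    have h2 := heq (contactX T s v w) (contactY T s v w) (by
      rw [wallFun_contact v w h, sub_self])
    rw [h2, zero_mul] at h1
    exact absurd h1 (lt_irrefl _)

end IsAdmissible

theorem turanGraph_four_adj {v w : Fin n} :
    (SimpleGraph.turanGraph n 4).Adj v w ↔ turanPart v ≠ turanPart w := by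
  simp [SimpleGraph.turanGraph_adj, turanPart]

theorem exists_isWallSystem_turanGraph (n : ℕ) :
    ∃ (φ : Fin n → Fin n → EuclideanSpace ℝ (Fin 2) →L[ℝ] ℝ) (c : Fin n → Fin n → ℝ),
      IsWallSystem (SimpleGraph.turanGraph n 4) φ c := by
  obtain ⟨T, s, hA⟩ := exists_isAdmissible n
  let φ : Fin n → Fin n → EuclideanSpace ℝ (Fin 2) →L[ℝ] ℝ := fun v w =>
    (cellFun T s v w 1 0 - cellFun T s v w 0 0) • EuclideanSpace.proj 0 +
      (cellFun T s v w 0 1 - cellFun T s v w 0 0) • EuclideanSpace.proj 1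
  let c : Fin n → Fin n → ℝ := fun v w => -cellFun T s v w 0 0
  have hφ : ∀ v w x y, φ v w !₂[x, y] - c v w = cellFun T s v w x y := by
    intro v w x y
    rw [cellFun_eq]
    simp [φ, c]
  have hmem : ∀ v w x y, !₂[x, y] ∈ hyperplane (φ v w) (c v w) ↔ cellFun T s v w x y = 0 := by
    intro v w x y
    rw [mem_hyperplane, ← hφ, sub_eq_zero]
  have hφ_swap : ∀ v w, (SimpleGraph.turanGraph n 4).Adj v w → φ w v = -φ v w := by
    intro v w hvw
    ext x
    simp only [φ, cellFun_swap T s (turanGraph_four_adj.1 hvw)]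
    simp
    ring
  have hc_swap : ∀ v w, (SimpleGraph.turanGraph n 4).Adj v w → c w v = -c v w := by
    intro v w hvw
    simp only [c, cellFun_swap T s (turanGraph_four_adj.1 hvw)]
  have hplane_swap : ∀ v w, (SimpleGraph.turanGraph n 4).Adj v w →
      hyperplane (φ w v) (c w v) = hyperplane (φ v w) (c v w) := by
    intro v w hvw
    ext x
    rw [mem_hyperplane, mem_hyperplane, hφ_swap v w hvw, hc_swap v w hvw, neg_apply, neg_inj]
  have hlt : ∀ v w, turanPart v < turanPart w → ∀ x y,
      cellFun T s v w x y = wallFun (turanPart v) (turanPart w) (T v) (s w) x y := by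
    intro v w h x y
    simp [cellFun, h]
  have hwall : ∀ v w, turanPart v < turanPart w → ∃ p, φ v w p = c v w ∧
      (∀ k, (SimpleGraph.turanGraph n 4).Adj v k → k ≠ w → c v k < φ v k p) ∧
      (∀ k, (SimpleGraph.turanGraph n 4).Adj w k → k ≠ v → c w k < φ w k p) := by
    intro v w h
    refine ⟨!₂[contactX T s v w, contactY T s v w], ?_, fun k hk hkw => ?_, fun k hk hkv => ?_⟩
    · rw [← sub_eq_zero, hφ, hlt v w h, IsAdmissible.wallFun_contact v w h, sub_self]
    · rw [← sub_pos, hφ]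
      exact (hA.cellFun_pos h).1 k (turanGraph_four_adj.1 hk) hkw
    · rw [← sub_pos, hφ]
      exact (hA.cellFun_pos h).2 k (turanGraph_four_adj.1 hk) hkv
  have hinj : ∀ v w k l, turanPart v < turanPart w → turanPart k < turanPart l →
      hyperplane (φ v w) (c v w) = hyperplane (φ k l) (c k l) → s(v, w) = s(k, l) := by
    intro v w k l h h' heq
    obtain ⟨rfl, rfl⟩ := hA.eq_of_forall_wallFun h h' fun x y hxy => by
      rwa [← hlt _ _ h, ← hmem, heq, hmem, hlt _ _ h'] at hxy
    rfl
  have hne : ∀ v w, turanPart v < turanPart w → φ v w ≠ 0 := by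
    intro v w h h0
    -- If `φ v w` vanished, the wall function would be constant, but its values at heights `0` and
    -- `1` over one point of the side differ.
    have h1 := hφ v w (pointX (turanPart v) (turanPart w) 0 0)
      (pointY (turanPart v) (turanPart w) 0 0)
    have h2 := hφ v w (pointX (turanPart v) (turanPart w) 0 1)
      (pointY (turanPart v) (turanPart w) 0 1)
    rw [hlt v w h, wallFun_point h, h0, zero_apply] at h1 h2
    linarith
  refine ⟨φ, c, ?_, hφ_swap, hc_swap, ?_, ?_, ?_⟩
  · intro i j k hij
    simp only [turanGraph_four_adj] at hij ⊢
    by_contra! h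
    exact hij (h.1.symm.trans h.2)
  · intro v w hvw
    rcases (turanGraph_four_adj.1 hvw).lt_or_gt with h | h
    · exact hne v w h
    · rw [hφ_swap w v hvw.symm]
      exact neg_ne_zero.2 (hne w v h)
  · intro v w hvw
    rcases (turanGraph_four_adj.1 hvw).lt_or_gt with h | h
    · exact hwall v w h
    · obtain ⟨p, hp, hp1, hp2⟩ := hwall w v h
      refine ⟨p, ?_, hp2, hp1⟩
      rw [hφ_swap w v hvw.symm, hc_swap w v hvw.symm, neg_apply, hp]
  · intro v w k l hvw hkl heq
    rcases (turanGraph_four_adj.1 hvw).lt_or_gt with h | h <;>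
      rcases (turanGraph_four_adj.1 hkl).lt_or_gt with h' | h'
    · exact hinj v w k l h h' heq
    · rw [Sym2.eq_swap (a := k)]
      exact hinj v w l k h h' (by rw [heq, hplane_swap _ _ hkl])
    · rw [Sym2.eq_swap (a := v)]
      exact hinj w v k l h h' (by rw [← heq, hplane_swap _ _ hvw])
    · rw [Sym2.eq_swap (a := k), Sym2.eq_swap (a := v)]
      exact hinj w v l k h h' (by rw [hplane_swap _ _ hvw, heq, hplane_swap _ _ hkl])

end PlanarWalls

theorem isGreatest_counts_plane (n : ℕ) :
    IsGreatest (strongCoverCounts 1 2 n) (turanNumber n 4 : ℕ∞) ∧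
      IsGreatest (ordinaryFlatCounts 1 2 n) (turanNumber n 4 : ℕ∞) := by
  classical
  obtain ⟨φ, c, h⟩ := exists_isWallSystem_turanGraph n
  refine isGreatest_counts (d := 2) (by norm_num) (fun K hK => ?_) h ?_
  · rw [← SimpleGraph.coe_edgeFinset, encard_coe_eq_coe_finsetCard]
    have := (SimpleGraph.isTuranMaximal_turanGraph (n := n) (r := 4) (by norm_num)).2
      (touchGraph_cliqueFree_five hK)
    exact_mod_cast this
  · rw [← SimpleGraph.coe_edgeFinset, encard_coe_eq_coe_finsetCard]
    exact le_of_eq (by congr)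

/-! ### Asymptotics of the Turán number. -/

/-- The number of edges of the Turán graph with four parts is `(3 / 4 + o(1)) n.choose 2`. -/
theorem exists_tendsto_turanNumber_four :
    ∃ ε : ℕ → ℝ, Tendsto ε atTop (𝓝 0) ∧
      ∀ n : ℕ, (turanNumber n 4 : ℝ) = (3 / 4 + ε n) * (n.choose 2 : ℝ) := by
  have hformula : ∀ n : ℕ, |8 * (turanNumber n 4 : ℝ) - 3 * n ^ 2| ≤ 27 := by
    intro n
    have h : turanNumber n 4 = (n ^ 2 - (n % 4) ^ 2) * 3 / 8 + (n % 4).choose 2 :=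
      SimpleGraph.card_edgeFinset_turanGraph
    obtain ⟨q, r, hr, rfl⟩ : ∃ q r, r < 4 ∧ n = 4 * q + r :=
      ⟨n / 4, n % 4, Nat.mod_lt _ (by norm_num), by omega⟩
    have hmod : (4 * q + r) % 4 = r := by omega
    have hdiv : ((4 * q + r) ^ 2 - r ^ 2) * 3 / 8 = 3 * (2 * q ^ 2 + q * r) := by
      have : (4 * q + r) ^ 2 - r ^ 2 = 8 * (2 * q ^ 2 + q * r) := by
        rw [Nat.sub_eq_iff_eq_add (Nat.pow_le_pow_left (by omega) 2)]; ring
      rw [this]; omega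
    rw [hmod, hdiv] at h
    rw [h]
    push_cast
    interval_cases r <;> norm_num [Nat.choose] <;> rw [abs_le] <;> constructor <;> nlinarith
  -- For `n ≤ 1` both sides vanish and any value of the error serves.
  refine ⟨fun n => if n ≤ 1 then 0 else turanNumber n 4 / (n.choose 2 : ℝ) - 3 / 4, ?_, ?_⟩
  · have hbound : ∀ n : ℕ, 2 ≤ n → |(turanNumber n 4 : ℝ) / (n.choose 2 : ℝ) - 3 / 4| ≤ 30 / n := by
      intro n hn
      have hn' : (2 : ℝ) ≤ n := by exact_mod_cast hn
      have hchoose : (n.choose 2 : ℝ) = n * (n - 1) / 2 := Nat.cast_choose_two ℝ n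
      have hpos : (0 : ℝ) < n * (n - 1) / 2 := by
        have : (0 : ℝ) < n - 1 := by linarith
        positivity
      have h := abs_le.1 (hformula n)
      rw [hchoose, abs_le]
      constructor
      · rw [neg_le_sub_iff_le_add, ← sub_le_iff_le_add, le_div_iff₀ hpos]
        have : (30 : ℝ) / n * (n * (n - 1) / 2) = 15 * (n - 1) := by field_simp; ring
        nlinarith
      · rw [sub_le_iff_le_add, div_le_iff₀ hpos]
        have : (30 : ℝ) / n * (n * (n - 1) / 2) = 15 * (n - 1) := by field_simp; ring
        nlinarith
    refine squeeze_zero_norm' ?_ (tendsto_const_div_atTop_nhds_zero_nat 30)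
    filter_upwards [eventually_ge_atTop 2] with n hn
    rw [if_neg (by omega), Real.norm_eq_abs]
    exact hbound n hn
  · intro n
    by_cases hn : n ≤ 1
    · have h : turanNumber n 4 = (n ^ 2 - (n % 4) ^ 2) * 3 / 8 + (n % 4).choose 2 :=
        SimpleGraph.card_edgeFinset_turanGraph
      rw [h]
      interval_cases n <;> simp
    · have hpos : (n.choose 2 : ℝ) ≠ 0 := by
        have := Nat.choose_pos (show 2 ≤ n by omega)
        positivity
      simp only [if_neg hn]
      field_simp
      ring

theorem theorem4 :
    (∀ n : ℕ, IsGreatest (strongCoverCounts 1 2 n) (turanNumber n 4 : ℕ∞) ∧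
      IsGreatest (ordinaryFlatCounts 1 2 n) (turanNumber n 4 : ℕ∞)) ∧
    (∃ ε : ℕ → ℝ, Tendsto ε atTop (𝓝 0) ∧
      ∀ n : ℕ, (turanNumber n 4 : ℝ) = (3 / 4 + ε n) * (n.choose 2 : ℝ)) ∧
    (∀ d : ℕ, 3 ≤ d → ∀ n : ℕ,
      IsGreatest (strongCoverCounts (d - 1) d n) (n.choose 2 : ℕ∞) ∧
      IsGreatest (ordinaryFlatCounts (d - 1) d n) (n.choose 2 : ℕ∞)) := by
  exact ⟨isGreatest_counts_plane, exists_tendsto_turanNumber_four,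
    fun _ hd n => isGreatest_counts_of_three_le hd n⟩
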